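/- **Theorem.** *Conventions.* For $n\ge 0$ let $C=\{0,\dots,n-1\}$. A *marked graph* $G[X;Y;R]$ is a finite simple graph with designated input vertices $X=\{x_0,\dots,x_{p-1}\}$, output vertices $Y=\{y_0,\dots,y_{q-1}\}$ and reference vertices $R=\{\tilde 0,\dots,\widetilde{n-1}\}$, where the vertices of $X\cup R$ are pairwise distinct and so are those of $Y$. Let $S=\{0,\dots,m-1\}$ with $m\ge 2$ and $n\ge\max\{m,3\}$, let $p,q\ge 1$, and let $\varphi:S^p\to S^q$ be a partial function. The marked graph $G$ *simulates $\varphi$ through $n$-colorings* if (i) $G$ is $n$-colorable (required only when $\varphi$ is defined at some point); (ii) every proper $n$-coloring of $G$ gives distinct colors to the vertices of $R$; (iii) an assignment $\sigma_0:X\cup R\to C$ with $\sigma_0(\tilde i)=i$ for all $i$ extends to a proper $C$-coloring $\sigma$ of $G$ if and only if $(\sigma_0(x_0),\dots,\sigma_0(x_{p-1}))$ lies in the domain of $\varphi$, and then $\sigma$ is unique and $\varphi(\sigma(x_0),\dots,\sigma(x_{p-1}))=(\sigma(y_0),\dots,\sigma(y_{q-1}))$. A *list-graph* $G[\mathcal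 L]$ is a graph with a list $L_z\subseteq C$ at each vertex $z$. The *direct forcing rule* on an edge $uv$ (from $u$ to $v$) replaces $L_v$ by $L_v\setminus L_u$ if $|L_u|=1$, by $\emptyset$ if $L_u=\emptyset$, and changes nothing otherwise. A *normal form* of $G[\mathcal L]$ is a list-graph obtained from it by finitely many applications of the rule on which no application of the rule has any further effect. For $\sigma_0$ as above, let $\mathcal L_{\sigma_0}$ be given by $L_z=\{\sigma_0(z)\}$ for $z\in X\cup R$ and $L_z=C$ otherwise. *Statement.* There are an algorithm $\mathcal A$ (a program of a random access machine with addition and subtraction, independent of $p,q,m,n,\varphi$), a polynomial $T$ with coefficients in $\mathbb N$ and a constant $K\in\mathbb N$ such that the following hold. 1. For every marked graph $G[X;Y;R]$ and every $\sigma_0:X\cup R\to C$ with $\sigma_0(\tilde i)=i$ for all $i$ (here $p,q,n\ge 0$ are arbitrary), the list-graph $G[\mathcal L_{\sigma_0}]$ has exactly one normal form $G[\mathcal L^*]$, and $\mathcal A$, given the binary code of $(G[X;Y;R],\sigma_0)$, a word of some length $N$ (containing the adjacency matrix of $G$), halts within $T(N)$ steps; it outputs the coloring presented by $\mathcal L^*$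 if all lists of $\mathcal L^*$ have size one, and otherwise it declares that there is no extension. 2. For all $p,q\ge1$, $m\ge 2$, $n\ge\max\{m,3\}$ and every partial function $\varphi:S^p\to S^q$ there is a marked graph $G_{\varphi,n}[X;Y;R]$ that simulates $\varphi$ through $n$-colorings, with $$|V(G_{\varphi,n})|\le K\,\Theta\,(p+q)\,n^{2(p+q)+4},\qquad |E(G_{\varphi,n})|\le K\,\Theta\,(p+q)\,n^{3(p+q)+5}$$ for every $\Theta\ge 1$ for which there are $s_0\in S$ and a permutation $\psi$ of $S^{p+q}$, equal to a product of $\Theta$ transpositions, such that for every $s$ in the domain of $\varphi$ the first $q$ entries of $\psi(s,s_0,\dots,s_0)$ are $\varphi(s)$; and such that for every $\sigma_0:X\cup R\to C$ with $\sigma_0(\tilde i)=i$ for all $i$ exactly one of the following holds: - $\sigma_0$ has a unique extension to a proper $C$-coloring $\sigma$ of $G_{\varphi,n}$, the normal form of $G_{\varphi,n}[\mathcal L_{\sigma_0}]$ has the lists $L^*_z=\{\sigma(z)\}$, and $\mathcal A$, given the code of $(G_{\varphi,n}[X;Y;R],\sigma_0)$, outputs $\sigma$ within $T(N)$ steps,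 where $N$ is the length of that code; - $\sigma_0$ has no extension to a proper $C$-coloring of $G_{\varphi,n}$, all lists of the normal form of $G_{\varphi,n}[\mathcal L_{\sigma_0}]$ are empty, and $\mathcal A$, given that code, declares within $T(N)$ steps that no extension exists. -/

import Mathlib

namespace GraphSim

/-! ### Random access machines with a step count -/

/-- Programs of a random access machine. It has registers `0, 1, 2, …` and memory arrays
`0, 1, 2, …`, all holding natural numbers; a program names finitely many registers and arrays.
Arithmetic is addition and truncated subtraction only (no multiplication), so that counting
elementary instructions is, up to a polynomial, the same as counting Turing machine steps. -/
inductive Prog : Type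
  /-- `reg d := c` -/
  | const (d c : ℕ) : Prog
  /-- `reg d := reg a + reg b` -/
  | add (d a b : ℕ) : Prog
  /-- `reg d := reg a - reg b` (truncated) -/
  | sub (d a b : ℕ) : Prog
  /-- `reg d := arr k [reg a]` -/
  | load (k d a : ℕ) : Prog
  /-- `arr k [reg a] := reg s` -/
  | store (k a s : ℕ) : Prog
  /-- first `P`, then `Q` -/
  | seq (P Q : Prog) : Prog
  /-- if `reg c ≠ 0` then `P` else `Q` -/
  | ite (c : ℕ) (P Q : Prog) : Prog
  /-- while `reg c ≠ 0` do `P` -/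
  | loop (c : ℕ) (P : Prog) : Prog

/-- A memory state: contents of the registers and of the arrays. -/
structure State where
  reg : ℕ → ℕ
  arr : ℕ → ℕ → ℕ

/-- The state after `reg d := v`. -/
def State.setReg (s : State) (d v : ℕ) : State :=
  { s with reg := Function.update s.reg d v }

/-- The state after `arr k [i] := v`. -/
def State.setArr (s : State) (k i v : ℕ) : State :=
  { s with arr := Function.update s.arr k (Function.update (s.arr k) i v) }

/-- `Exec P s t s'`: the program `P`, started in the state `s`, halts in the state `s'` after
exactly `t` steps. Every elementary instruction and every test costs one step. -/
inductive Exec : Prog → State → ℕ → State → Prop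
  | const (d c : ℕ) (s : State) : Exec (.const d c) s 1 (s.setReg d c)
  | add (d a b : ℕ) (s : State) : Exec (.add d a b) s 1 (s.setReg d (s.reg a + s.reg b))
  | sub (d a b : ℕ) (s : State) : Exec (.sub d a b) s 1 (s.setReg d (s.reg a - s.reg b))
  | load (k d a : ℕ) (s : State) : Exec (.load k d a) s 1 (s.setReg d (s.arr k (s.reg a)))
  | store (k a b : ℕ) (s : State) :
      Exec (.store k a b) s 1 (s.setArr k (s.reg a) (s.reg b))
  | seq {P Q : Prog} {s s' s'' : State} {t t' : ℕ} :
      Exec P s t s' → Exec Q s' t' s'' → Exec (.seq P Q) s (t + t') s''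
  | ite_true {c : ℕ} {P Q : Prog} {s s' : State} {t : ℕ} :
      s.reg c ≠ 0 → Exec P s t s' → Exec (.ite c P Q) s (t + 1) s'
  | ite_false {c : ℕ} {P Q : Prog} {s s' : State} {t : ℕ} :
      s.reg c = 0 → Exec Q s t s' → Exec (.ite c P Q) s (t + 1) s'
  | loop_stop {c : ℕ} {P : Prog} {s : State} :
      s.reg c = 0 → Exec (.loop c P) s 1 s
  | loop_step {c : ℕ} {P : Prog} {s s' s'' : State} {t t' : ℕ} :
      s.reg c ≠ 0 → Exec P s t s' → Exec (.loop c P) s' t' s'' →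
        Exec (.loop c P) s (t + t' + 1) s''

/-- The initial state on a binary input word: register `0` holds its length, array `0` holds its
bits, and everything else is `0`. -/
def State.init (w : List Bool) : State where
  reg := fun d => if d = 0 then w.length else 0
  arr := fun k i => if k = 0 then (w.getD i false).toNat else 0

/-- The output word of a final state: register `0` holds its length, array `1` its bits. -/
def State.HasOutput (s : State) (w : List Bool) : Prop :=
  s.reg 0 = w.length ∧ ∀ (i : ℕ) (h : i < w.length), s.arr 1 i = (w[i]).toNat

/-- On the input word `w` the program `P` halts within `b` steps with the output word `out`. -/
def Prog.OutputsWithin (P : Prog) (w out : List Bool) (b : ℕ) : Prop :=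
  ∃ (t : ℕ) (s : State), t ≤ b ∧ Exec P (State.init w) t s ∧ s.HasOutput out

/-! ### List-graphs and the direct forcing rule -/

section Forcing

variable {V C : Type*} [DecidableEq V] [DecidableEq C]

/-- The direct forcing rule applied on the edge `uv`, from `u` to `v`. -/
def force (u v : V) (L : V → Finset C) : V → Finset C := fun z =>
  if z = v ∧ (L u).card = 1 then L z \ L u
  else if z = v ∧ L u = ∅ then ∅
  else L z

/-- One reduction step between list-graphs on the graph `G`. -/
def Reduces (G : SimpleGraph V) (L L' : V → Finset C) : Prop :=
  L' ≠ L ∧ ∃ u v : V, G.Adj u v ∧ L' = force u v L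

/-- `G[L']` is a normal form of `G[L]`: it is reached from `G[L]` by finitely many reduction
steps, and no reduction step applies to it. -/
def IsNormalForm (G : SimpleGraph V) (L L' : V → Finset C) : Prop :=
  Relation.ReflTransGen (Reduces G) L L' ∧ ∀ L'' : V → Finset C, ¬ Reduces G L' L''

end Forcing

/-! ### Graphs marked by inputs, outputs and reference vertices; simulation of functions -/

/-- A finite simple graph with `p` input vertices, `q` output vertices and `n` reference
vertices. Input and reference vertices are pairwise distinct, so that an assignment of colors to
them can be prescribed freely; output vertices are pairwise distinct. -/
structure MarkedGraph (p q n : ℕ) where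
  ν : ℕ
  graph : SimpleGraph (Fin ν)
  x : Fin p → Fin ν
  y : Fin q → Fin ν
  r : Fin n → Fin ν
  xr_injective : Function.Injective (Sum.elim x r)
  y_injective : Function.Injective y

variable {p q m n : ℕ}

/-- The proper `n`-coloring `σ` extends the assignment `σ₀` on the input and reference vertices
with `σ₀ (x j) = a j` and `σ₀ (r i) = i`. -/
def MarkedGraph.Extends (M : MarkedGraph p q n) (a : Fin p → Fin n)
    (σ : M.graph.Coloring (Fin n)) : Prop :=
  (∀ j, σ (M.x j) = a j) ∧ ∀ i, σ (M.r i) = i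

/-- The lists of `σ₀`: `{σ₀ z}` where `σ₀` is defined, and the set of all colors elsewhere. -/
def MarkedGraph.initialLists (M : MarkedGraph p q n) (a : Fin p → Fin n) :
    Fin M.ν → Finset (Fin n) := fun z =>
  {c : Fin n | (∀ j, M.x j = z → c = a j) ∧ ∀ i, M.r i = z → c = i}

/-- `M` simulates the partial function `φ` from `S ^ p` to `S ^ q`, where `S = {0, …, m-1}`,
through `n`-colorings. (If `φ` is nowhere defined, then `extends_iff` and `ref_injective` exclude
every `n`-coloring; so `n`-colorability is asked for only if `φ` is defined somewhere.) -/
structure MarkedGraph.Simulates (M : MarkedGraph p q n)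
    (φ : (Fin p → Fin m) →. (Fin q → Fin m)) : Prop where
  colorable : φ.Dom.Nonempty → M.graph.Colorable n
  ref_injective : ∀ σ : M.graph.Coloring (Fin n), Function.Injective fun i => σ (M.r i)
  extends_iff : ∀ a : Fin p → Fin n,
    (∃ σ : M.graph.Coloring (Fin n), M.Extends a σ) ↔
      ∃ s ∈ φ.Dom, ∀ j, (s j : ℕ) = a j
  unique : ∀ (a : Fin p → Fin n) (σ τ : M.graph.Coloring (Fin n)),
    M.Extends a σ → M.Extends a τ → σ = τ
  value : ∀ (a : Fin p → Fin n) (σ : M.graph.Coloring (Fin n)), M.Extends a σ →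
    ∀ (s : Fin p → Fin m) (w : Fin q → Fin m), (∀ j, (s j : ℕ) = a j) → w ∈ φ s →
      ∀ l, (σ (M.y l) : ℕ) = w l

/-- The permutation `ψ` of `S ^ (p + q)` is an invertible extension of `φ`: for some `s₀ ∈ S`,
whenever `φ s` is defined, `ψ (s, s₀, …, s₀)` begins with the `q` entries of `φ s`. -/
def IsInvertibleExtension (φ : (Fin p → Fin m) →. (Fin q → Fin m))
    (ψ : Equiv.Perm (Fin (p + q) → Fin m)) : Prop :=
  ∃ s₀ : Fin m, ∀ (s : Fin p → Fin m) (w : Fin q → Fin m), w ∈ φ s →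
    ∀ l : Fin q, ψ (Fin.append s fun _ => s₀) (Fin.castLE (Nat.le_add_left q p) l) = w l

/-- Some invertible extension of `φ` can be presented using `Θ` transpositions of
`S ^ (p + q)`. -/
def HasPresentation (φ : (Fin p → Fin m) →. (Fin q → Fin m)) (Θ : ℕ) : Prop :=
  ∃ l : List (Equiv.Perm (Fin (p + q) → Fin m)),
    l.length = Θ ∧ (∀ τ ∈ l, τ.IsSwap) ∧ IsInvertibleExtension φ l.prod

/-! ### Binary codes of inputs and outputs -/

/-- The rows, from top to bottom, of the 0-1 matrix of a relation. -/
noncomputable def bitMatrix {a b : ℕ} (A : Fin a → Fin b → Prop) : List Bool :=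
  open Classical in
  (List.finRange a).flatMap fun i => (List.finRange b).map fun j => decide (A i j)

/-- `k` ones followed by a zero. -/
def unary (k : ℕ) : List Bool := List.replicate k true ++ [false]

/-- The code of a marked graph and of an assignment `σ₀` with `σ₀ (x j) = a j` and
`σ₀ (r i) = i`: the numbers of vertices, colors, inputs and outputs in unary, the adjacency
matrix, the positions of the input, output and reference vertices, and the colors of the inputs
(vertices and colors as characteristic vectors). -/
noncomputable def MarkedGraph.code (M : MarkedGraph p q n) (a : Fin p → Fin n) : List Bool :=
  unary M.ν ++ unary n ++ unary p ++ unary q ++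
    bitMatrix (fun u v => M.graph.Adj u v) ++
    bitMatrix (fun j v => M.x j = v) ++ bitMatrix (fun l v => M.y l = v) ++
    bitMatrix (fun i v => M.r i = v) ++ bitMatrix (fun j c => a j = c)

/-- The answer "the coloring is `σ`": a one, then `σ` with colors as characteristic vectors. -/
noncomputable def foundCode {ν : ℕ} (σ : Fin ν → Fin n) : List Bool :=
  true :: bitMatrix (fun z c => σ z = c)

/-- The answer "there is no coloring". -/
def noneCode : List Bool := [false]

/-- The answer read off from lists `L`: if every list has exactly one color, the coloring that
they present, and otherwise "there is no coloring". -/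
noncomputable def answer {ν : ℕ} (L : Fin ν → Finset (Fin n)) : List Bool :=
  open Classical in
  if h : ∀ z, ∃ c, L z = {c} then foundCode (fun z => (h z).choose) else noneCode

end GraphSim

/-! Normal forms. Call a family of lists stable when a list contained in `{c}` excludes `c` from all
neighboring lists. Forcing only shrinks lists, and a stable family below the current lists stays
below them after every application (`Stable.le_force`). So the process stops, and it can only stop
at the greatest stable family below the initial lists; this gives existence and uniqueness. The
singletons of a proper extension form a stable family, so an upper bound for stable families
controls colorings as well.

Simulation. The graph of `φ` is a lookup table written as a circuit of conjunction gates. With `n =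
N + 1` colors, `0` and `N` stand for false and true. Reference vertices impose lists: the one of
color `c` is joined to every vertex that must avoid `c`. Threshold vertices translate a color `k`
into the bits `k ≤ i` and, at the outputs, back. Forcing evaluates the gates in the order of their
rank, so every list shrinks into one prescribed color (`Closed.eq_color`), and these colors form a
proper coloring (`color_ne`). An input outside the domain makes true a gate whose list lacks `N`;
its list becomes empty, and emptiness spreads to all vertices (`Closed.forall_not_of_pos`). There
are at most `12 (p + q) n ^ (p + 1)` vertices, and at most the square of this many edges, which is
within the bounds already for `Θ = 1`.

Algorithm. A color is dead at a vertex if no stable family below the initial lists contains it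
there. The program marks dead colors: in each round, whenever all colors but `c` are marked at a
vertex, it marks `c` at the neighbors. A round that does not start from a fixed point adds a mark,
so as many rounds as the input is long suffice (`propagate_run`). Programs are written in a language
whose loops all have this length, so that correctness follows from loop invariants and a polynomial
time bound from the syntax (`BProg.exec`). -/

namespace GraphSim

/-! ### Normal forms as greatest stable families -/

section NormalForms

variable {V C : Type*} [DecidableEq V] [DecidableEq C]

/-- No edge can force anything in the list-graph `G[L]`. -/
def Stable (G : SimpleGraph V) (L : V → Finset C) : Prop :=
  ∀ u v c, G.Adj u v → L u ⊆ {c} → c ∉ L v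

theorem force_le (u v : V) (L : V → Finset C) : force u v L ≤ L := by
  intro z
  unfold force
  split_ifs
  · exact Finset.sdiff_subset
  · simp
  · exact le_rfl

/-- A set inside `{c}` is empty or equal to `{c}`, and these are the two active branches of the
rule. Either one would remove `c` from the list of `v`, so the rule would have an effect. -/
theorem stable_of_irreducible {G : SimpleGraph V} {L : V → Finset C}
    (h : ∀ L', ¬ Reduces G L L') : Stable G L := by
  intro u v c huv hu hc
  refine h (force u v L) ⟨fun he => ?_, u, v, huv, rfl⟩
  have hv := congrFun he v
  rcases Finset.subset_singleton_iff.1 hu with h0 | h1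
  · simp only [force, h0] at hv
    simp at hv
    simp [← hv] at hc
  · simp only [force, h1] at hv
    simp at hv
    exact hv hc

/-- Forcing is monotone in this sense: since `M u ⊆ L u`, a color that `u` expels from `L v` is
already expelled from `M v` by stability. This replaces a confluence argument. -/
theorem Stable.le_force {G : SimpleGraph V} {L M : V → Finset C} (hM : Stable G M)
    (hle : M ≤ L) {u v : V} (huv : G.Adj u v) : M ≤ force u v L := by
  intro z c hc
  unfold force
  split_ifs with h1 h2
  · obtain ⟨rfl, h1⟩ := h1
    obtain ⟨d, hd⟩ := Finset.card_eq_one.1 h1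
    refine Finset.mem_sdiff.2 ⟨hle _ hc, fun h => ?_⟩
    rw [hd, Finset.mem_singleton] at h
    subst h
    exact hM u z c huv (hd ▸ hle u) hc
  · obtain ⟨rfl, h2⟩ := h2
    exact absurd hc (hM u z c huv ((hle u).trans (by rw [h2]; simp)))
  · exact hle _ hc

theorem Stable.le_of_reduces {G : SimpleGraph V} {L L' M : V → Finset C} (hM : Stable G M)
    (hle : M ≤ L) (h : Relation.ReflTransGen (Reduces G) L L') : M ≤ L' := by
  induction h with
  | refl => exact hle
  | tail _ h ih =>
    obtain ⟨-, u, v, huv, rfl⟩ := h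
    exact hM.le_force ih huv

theorem le_of_reflTransGen {G : SimpleGraph V} {L L' : V → Finset C}
    (h : Relation.ReflTransGen (Reduces G) L L') : L' ≤ L := by
  induction h with
  | refl => exact le_rfl
  | tail _ h ih =>
    obtain ⟨-, u, v, huv, rfl⟩ := h
    exact (force_le u v _).trans ih

/-- Every effective step lowers the total size of the lists. -/
theorem exists_isNormalForm [Fintype V] (G : SimpleGraph V) (L : V → Finset C) :
    ∃ L', IsNormalForm G L L' := by
  induction hk : ∑ z, (L z).card using Nat.strong_induction_on generalizing L with
  | _ k ih =>
    by_cases h : ∃ L', Reduces G L L'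
    · obtain ⟨L', hL⟩ := h
      have hle : L' ≤ L := le_of_reflTransGen (.single hL)
      have hlt : ∑ z, (L' z).card < k := by
        rw [← hk]
        obtain ⟨z, hz⟩ := Function.ne_iff.1 hL.1
        exact Finset.sum_lt_sum (fun z _ => Finset.card_le_card (hle z))
          ⟨z, Finset.mem_univ z, Finset.card_lt_card ((hle z).lt_of_ne hz)⟩
      obtain ⟨L'', h1, h2⟩ := ih _ hlt L' rfl
      exact ⟨L'', .head hL h1, h2⟩
    · push Not at h
      exact ⟨L, .refl, h⟩

/-- The normal form is the greatest stable list-graph below the given one. -/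
theorem IsNormalForm.eq_of_greatest {G : SimpleGraph V} {L L' M : V → Finset C}
    (h : IsNormalForm G L L') (hM : Stable G M) (hle : M ≤ L)
    (hmax : ∀ M', Stable G M' → M' ≤ L → M' ≤ M) : L' = M :=
  le_antisymm (hmax _ (stable_of_irreducible h.2) (le_of_reflTransGen h.1))
    (hM.le_of_reduces hle h.1)

theorem IsNormalForm.unique {G : SimpleGraph V} {L L' L'' : V → Finset C}
    (h' : IsNormalForm G L L') (h'' : IsNormalForm G L L'') : L'' = L' :=
  h''.eq_of_greatest (stable_of_irreducible h'.2) (le_of_reflTransGen h'.1)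
    fun _ hM hle => hM.le_of_reduces hle h'.1

end NormalForms

end GraphSim
namespace GraphSim

/-! ### Boolean circuits as list-graphs -/

/-- The vertices of the graph of a circuit with gates `Γ`, for `N + 1` colors: reference vertices,
inputs and outputs, for each of them the vertices that compare its color with the thresholds
`i < N`, and five vertices for each gate. -/
inductive Vtx (p q N : ℕ) (Γ : Type) : Type
  | ref (c : Fin (N + 1))
  | top (t : Fin p ⊕ Fin q)
  | cut (t : Fin p ⊕ Fin q) (i : Fin N)
  | hi (t : Fin p ⊕ Fin q) (i : Fin N)
  | lo (t : Fin p ⊕ Fin q) (i : Fin N)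
  | le (t : Fin p ⊕ Fin q) (i : Fin N)
  | gt (t : Fin p ⊕ Fin q) (i : Fin N)
  | three (g : Γ)
  | right (g : Γ)
  | left (g : Γ)
  | pos (g : Γ)
  | neg (g : Γ)

/-- The sources from which a gate can read. -/
inductive Wire (p N : ℕ) (Γ : Type) : Type
  | one
  | le (j : Fin p) (i : Fin N)
  | gt (j : Fin p) (i : Fin N)
  | pos (g : Γ)
  | neg (g : Γ)

/-- A circuit of conjunction gates. The gate `out l i` decides whether the color of the output
`l` is at most `i`; the gates in `bad` are required to be false. -/
structure Circuit (p q N : ℕ) (Γ : Type) where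
  in1 : Γ → Wire p N Γ
  in2 : Γ → Wire p N Γ
  out : Fin q → Fin N → Γ
  bad : Γ → Prop

variable {p q N : ℕ} {Γ : Type}

/-- The vertex that carries the value of a source. -/
def Wire.vtx (q : ℕ) : Wire p N Γ → Vtx p q N Γ
  | one => .ref (Fin.last N)
  | le j i => .le (.inl j) i
  | gt j i => .gt (.inl j) i
  | pos g => .pos g
  | neg g => .neg g

/-- The value of a source for inputs `a` and gate values `val`. -/
def Wire.val (a : Fin p → ℕ) (val : Γ → Bool) : Wire p N Γ → Bool
  | one => true
  | le j i => decide (a j ≤ i)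
  | gt j i => decide (i < a j)
  | pos g => val g
  | neg g => !val g

/-- The color that stands for a truth value. -/
def boolColor (N : ℕ) (b : Bool) : ℕ := if b then N else 0

/-- A source reads from gates of rank below `k` only. -/
def Wire.Below (rank : Γ → ℕ) (k : ℕ) : Wire p N Γ → Prop
  | pos g => rank g < k
  | neg g => rank g < k
  | _ => True

namespace Circuit

variable (D : Circuit p q N Γ)

/-- The colors that the list of a vertex contains. -/
def Allowed : Vtx p q N Γ → ℕ → Prop
  | .ref c, d => d = c
  | .top _, _ => True
  | .cut _ i, d => d = i ∨ d = i + 1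
  | .hi _ i, d => d = i + 1 ∨ d = 0
  | .lo _ i, d => d = i ∨ d = N
  | .le _ _, d => d = 0 ∨ d = N
  | .gt _ _, d => d = 0 ∨ d = N
  | .three _, d => d = 0 ∨ d = 1 ∨ d = N
  | .right _, d => d = 1 ∨ d = N
  | .left _, d => d = 0 ∨ d = 1
  | .pos g, d => d = 0 ∨ d = N ∧ ¬ D.bad g
  | .neg _, d => d = 0 ∨ d = N

/-- The edges of the graph of a circuit, each in one direction. -/
inductive Edge : Vtx p q N Γ → Vtx p q N Γ → Prop
  | ref (c : Fin (N + 1)) (z : Vtx p q N Γ) : ¬ D.Allowed z c → Edge (.ref c) z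
  | top_cut (t i) : Edge (.top t) (.cut t i)
  | cut_cut (t) (i j : Fin N) : (j : ℕ) = i + 1 → Edge (.cut t i) (.cut t j)
  | cut_hi (t i) : Edge (.cut t i) (.hi t i)
  | hi_le (t i) : Edge (.hi t i) (.le t i)
  | cut_lo (t i) : Edge (.cut t i) (.lo t i)
  | lo_le (t i) : Edge (.lo t i) (.le t i)
  | le_gt (t i) : Edge (.le t i) (.gt t i)
  | le_neg (l i) : Edge (.le (.inr l) i) (.neg (D.out l i))
  | in1_right (g) : Edge ((D.in1 g).vtx q) (.right g)
  | in1_left (g) : Edge ((D.in1 g).vtx q) (.left g)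
  | in2_three (g) : Edge ((D.in2 g).vtx q) (.three g)
  | pos_three (g) : Edge (.pos g) (.three g)
  | pos_right (g) : Edge (.pos g) (.right g)
  | three_right (g) : Edge (.three g) (.right g)
  | right_left (g) : Edge (.right g) (.left g)
  | pos_neg (g) : Edge (.pos g) (.neg g)

/-- The graph of a circuit. -/
def graph : SimpleGraph (Vtx p q N Γ) := SimpleGraph.fromRel D.Edge

variable {D}

/-- Needed because `SimpleGraph.fromRel` discards loops: only for distinct ends does an `Edge`
become an adjacency. -/
theorem Edge.ne {x y : Vtx p q N Γ} (h : D.Edge x y) : x ≠ y := by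
  intro hxy
  cases h with
  | ref c z h => subst hxy; exact h rfl
  | cut_cut t i j h => simp at hxy; subst hxy; omega
  | in1_right g => revert hxy; cases D.in1 g <;> simp [Wire.vtx]
  | in1_left g => revert hxy; cases D.in1 g <;> simp [Wire.vtx]
  | in2_three g => revert hxy; cases D.in2 g <;> simp [Wire.vtx]
  | _ => simp at hxy

theorem Edge.adj {x y : Vtx p q N Γ} (h : D.Edge x y) : D.graph.Adj x y :=
  (SimpleGraph.fromRel_adj _ _ _).2 ⟨h.ne, .inl h⟩

/-- A family of sets of colors on the graph of a circuit that is closed under direct forcing,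
below the initial lists for the inputs `a`. -/
structure Closed (D : Circuit p q N Γ) (a : Fin p → ℕ) (M : Vtx p q N Γ → ℕ → Prop) : Prop where
  color_le : ∀ z c, M z c → c ≤ N
  ref : ∀ c d, M (.ref c) d → d = c
  input : ∀ j d, M (.top (.inl j)) d → d = a j
  adj : ∀ x y c, D.graph.Adj x y → (∀ d, M x d → d = c) → ¬ M y c

/-! ### Direct forcing through the gadgets -/

namespace Closed

variable {a : Fin p → ℕ} {M : Vtx p q N Γ → ℕ → Prop}

theorem fwd (h : D.Closed a M) {x y : Vtx p q N Γ} (e : D.Edge x y) {c : ℕ}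
    (hx : ∀ d, M x d → d = c) : ¬ M y c :=
  h.adj x y c e.adj hx

theorem bwd (h : D.Closed a M) {x y : Vtx p q N Γ} (e : D.Edge x y) {c : ℕ}
    (hy : ∀ d, M y d → d = c) : ¬ M x c :=
  h.adj y x c e.adj.symm hy

/-- If `d` is not allowed at `z`, then `z` is adjacent to the reference vertex of color `d`, which
expels it. In this way lists are encoded by edges. -/
theorem allowed (h : D.Closed a M) {z : Vtx p q N Γ} {d : ℕ} (hd : M z d) : D.Allowed z d := by
  by_contra hz
  have hN := h.color_le z d hd
  exact h.fwd (.ref ⟨d, by omega⟩ z hz) (c := d) (fun d' hd' => h.ref _ _ hd') hd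

/-- The colors of the vertices at a threshold `i` are those for an input of color `k`. -/
def CutForced (M : Vtx p q N Γ → ℕ → Prop) (t : Fin p ⊕ Fin q) (i : Fin N) (k : ℕ) : Prop :=
  (∀ d, M (.cut t i) d → d = if k ≤ i then (i : ℕ) + 1 else (i : ℕ)) ∧
  (∀ d, M (.hi t i) d → d = if k ≤ i then 0 else (i : ℕ) + 1) ∧
  (∀ d, M (.lo t i) d → d = if k ≤ i then (i : ℕ) else N) ∧
  (∀ d, M (.le t i) d → d = boolColor N (decide (k ≤ i))) ∧
  (∀ d, M (.gt t i) d → d = boolColor N (decide (i < k)))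

theorem gt_forced (h : D.Closed a M) (hN : 2 ≤ N) {t : Fin p ⊕ Fin q} {i : Fin N} {k : ℕ}
    (hle : ∀ d, M (.le t i) d → d = boolColor N (decide (k ≤ i))) :
    ∀ d, M (.gt t i) d → d = boolColor N (decide (i < k)) := by
  intro d hd
  have h1 := h.allowed hd
  have h2 := h.fwd (.le_gt t i) hle
  simp only [Allowed, boolColor, decide_eq_true_eq] at h1 h2 ⊢
  split_ifs at h2 ⊢ <;> rcases h1 with rfl | rfl <;> first | rfl | omega | exact absurd hd h2

/-- All lists in this gadget have two colors, so forcing runs around the cycle `cut`, `hi`, `le`,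
`lo`. Color `i + 1` at `cut` leaves `0` at `hi`, hence `N` at `le`, hence `i` at `lo`. Color `i`
sends the same argument around the cycle the other way. -/
theorem cutForced_of_cut (h : D.Closed a M) (hN : 2 ≤ N) {t : Fin p ⊕ Fin q} {i : Fin N} {k : ℕ}
    (hcut : ∀ d, M (.cut t i) d → d = if k ≤ i then (i : ℕ) + 1 else (i : ℕ)) :
    CutForced M t i k := by
  have hi := i.2
  by_cases hk : k ≤ i
  · simp only [hk, if_true] at hcut
    have h1 : ∀ d, M (.hi t i) d → d = 0 := fun d hd => by
      rcases h.allowed hd with rfl | rfl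
      · exact absurd hd (h.fwd (.cut_hi t i) hcut)
      · rfl
    have h2 : ∀ d, M (.le t i) d → d = N := fun d hd => by
      rcases h.allowed hd with rfl | rfl
      · exact absurd hd (h.fwd (.hi_le t i) h1)
      · rfl
    have h3 : ∀ d, M (.lo t i) d → d = i := fun d hd => by
      rcases h.allowed hd with rfl | rfl
      · rfl
      · exact absurd hd (h.bwd (.lo_le t i) h2)
    refine ⟨by simpa [hk] using hcut, by simpa [hk] using h1, by simpa [hk] using h3,
      by simpa [hk, boolColor] using h2, h.gt_forced hN (by simpa [hk, boolColor] using h2)⟩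
  · simp only [hk, if_false] at hcut
    have h1 : ∀ d, M (.lo t i) d → d = N := fun d hd => by
      rcases h.allowed hd with rfl | rfl
      · exact absurd hd (h.fwd (.cut_lo t i) hcut)
      · rfl
    have h2 : ∀ d, M (.le t i) d → d = 0 := fun d hd => by
      rcases h.allowed hd with rfl | rfl
      · rfl
      · exact absurd hd (h.fwd (.lo_le t i) h1)
    have h3 : ∀ d, M (.hi t i) d → d = i + 1 := fun d hd => by
      rcases h.allowed hd with rfl | rfl
      · rfl
      · exact absurd hd (h.bwd (.hi_le t i) h2)
    refine ⟨by simpa [hk] using hcut, by simpa [hk] using h3, by simpa [hk] using h1,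
      by simpa [hk, boolColor] using h2, h.gt_forced hN (by simpa [hk, boolColor] using h2)⟩

/-- The list of `cut t i` is `{i, i + 1}`. Color `k` at the top decides the cuts `k - 1` and `k`,
which lose their common color `k`; the path of cuts then carries the decision upward from `k` and
downward from `k - 1`. -/
theorem cutForced_of_top (h : D.Closed a M) (hN : 2 ≤ N) {t : Fin p ⊕ Fin q} {k : ℕ}
    (ht : ∀ d, M (.top t) d → d = k) (i : Fin N) : CutForced M t i k := by
  apply h.cutForced_of_cut hN
  have up : ∀ i : ℕ, k ≤ i → ∀ hi : i < N, ∀ d, M (.cut t ⟨i, hi⟩) d → d = i + 1 := by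
    intro i hki
    induction i, hki using Nat.le_induction with
    | base =>
      intro hi d hd
      rcases h.allowed hd with rfl | rfl
      · exact absurd hd (h.fwd (.top_cut t _) ht)
      · rfl
    | succ i hki ih =>
      intro hi d hd
      rcases h.allowed hd with rfl | rfl
      · exact absurd hd (h.fwd (.cut_cut t ⟨i, by omega⟩ ⟨i + 1, hi⟩ rfl) (ih _))
      · rfl
  have down : ∀ m i : ℕ, i + m + 1 = k → ∀ hi : i < N, ∀ d, M (.cut t ⟨i, hi⟩) d → d = i := by
    intro m
    induction m with
    | zero =>
      intro i hik hi d hd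
      rcases h.allowed hd with rfl | rfl
      · rfl
      · exact absurd hd (h.fwd (.top_cut t _) fun d hd => by rw [ht d hd]; simp; omega)
    | succ m ih =>
      intro i hik hi d hd
      rcases h.allowed hd with rfl | rfl
      · rfl
      · by_cases hi' : i + 1 < N
        · exact absurd hd (h.bwd (.cut_cut t ⟨i, hi⟩ ⟨i + 1, hi'⟩ rfl)
            (ih (i + 1) (by omega) hi'))
        -- Here `i + 1 = N < k`, so no color at all is left at the top, and an empty list forces as
        -- well.
        · exact absurd hd (h.fwd (.top_cut t _) fun d hd' => by
            have := h.color_le _ _ hd'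
            have := ht d hd'
            simp; omega)
  intro d hd
  split_ifs with hk
  · exact up i hk i.2 d hd
  · exact down (k - i - 1) i (by omega) i.2 d hd

/-- The same cycle read from `le`, as needed at outputs, where the bit is known before the color. -/
theorem cutForced_of_le (h : D.Closed a M) (hN : 2 ≤ N) {t : Fin p ⊕ Fin q} {i : Fin N} {k : ℕ}
    (hle : ∀ d, M (.le t i) d → d = boolColor N (decide (k ≤ i))) : CutForced M t i k := by
  apply h.cutForced_of_cut hN
  by_cases hk : k ≤ i
  · simp only [hk, decide_true, boolColor, if_true] at hle
    have h1 : ∀ d, M (.lo t i) d → d = i := fun d hd => by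
      rcases h.allowed hd with rfl | rfl
      · rfl
      · exact absurd hd (h.bwd (.lo_le t i) hle)
    intro d hd
    rw [if_pos hk]
    rcases h.allowed hd with rfl | rfl
    · exact absurd hd (h.bwd (.cut_lo t i) h1)
    · rfl
  · simp only [hk, decide_false, boolColor] at hle
    have h1 : ∀ d, M (.hi t i) d → d = i + 1 := fun d hd => by
      rcases h.allowed hd with rfl | rfl
      · rfl
      · exact absurd hd (h.bwd (.hi_le t i) hle)
    intro d hd
    rw [if_neg hk]
    rcases h.allowed hd with rfl | rfl
    · rfl
    · exact absurd hd (h.bwd (.cut_hi t i) h1)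

/-- The cuts below `k` have the colors `0, …, k - 1` and the others `k + 1, …, N`. All are adjacent
to the top, which keeps only `k`. -/
theorem top_of_cutForced (h : D.Closed a M) {t : Fin p ⊕ Fin q} {k : ℕ} (hk : k ≤ N)
    (hcut : ∀ i, CutForced M t i k) : ∀ d, M (.top t) d → d = k := by
  intro d hd
  have hdN := h.color_le _ _ hd
  by_contra hne
  rcases Nat.lt_or_gt_of_ne hne with hlt | hgt
  · refine h.bwd (.top_cut t ⟨d, by omega⟩) (c := d) (fun d' hd' => ?_) hd
    rw [(hcut _).1 d' hd', if_neg (by simpa using hlt)]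
  · refine h.bwd (.top_cut t ⟨d - 1, by omega⟩) (c := d) (fun d' hd' => ?_) hd
    rw [(hcut _).1 d' hd', if_pos (by simp; omega)]
    simp; omega

/-- The colors of the vertices of a gate whose sources have the values `b₁` and `b₂`. -/
def gateColor (N : ℕ) (b₁ b₂ : Bool) : ℕ × ℕ × ℕ :=
  (if b₂ then (if b₁ then 0 else 1) else (if b₁ then N else 1),
    if b₁ then 1 else N, if b₁ then 0 else 1)

/-- The colors of the vertices of a gate are those for sources of values `b₁` and `b₂`. -/
def GateForced (M : Vtx p q N Γ → ℕ → Prop) (g : Γ) (b₁ b₂ : Bool) : Prop :=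
  (∀ d, M (.three g) d → d = (gateColor N b₁ b₂).1) ∧
  (∀ d, M (.right g) d → d = (gateColor N b₁ b₂).2.1) ∧
  (∀ d, M (.left g) d → d = (gateColor N b₁ b₂).2.2) ∧
  (∀ d, M (.pos g) d → d = boolColor N (b₁ && b₂)) ∧
  (∀ d, M (.neg g) d → d = boolColor N (!(b₁ && b₂)))

/-- A false first source takes `0` from `left`, so `left`, `right`, `pos`, `three` receive `1, N, 0,
1` in turn. A true one takes `N` from `right`; then `right` is `1`, `left` is `0`, and `three` is
reduced to `{0, N}`, where the second source decides, and `pos` receives the opposite color. This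
uses that `0, 1, N` are distinct. The conclusions are inclusions only, so they also cover a bad gate
whose list becomes empty. -/
theorem gateForced (h : D.Closed a M) (hN : 2 ≤ N) {g : Γ} {b₁ b₂ : Bool}
    (h₁ : ∀ d, M ((D.in1 g).vtx q) d → d = boolColor N b₁)
    (h₂ : ∀ d, M ((D.in2 g).vtx q) d → d = boolColor N b₂) : GateForced M g b₁ b₂ := by
  have hneg : (∀ d, M (.pos g) d → d = boolColor N (b₁ && b₂)) →
      ∀ d, M (.neg g) d → d = boolColor N (!(b₁ && b₂)) := by
    intro hp d hd
    have h1 := h.allowed hd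
    have h2 := h.fwd (.pos_neg g) hp
    revert h2
    cases (b₁ && b₂) <;> intro h2 <;> simp [Allowed, boolColor] at h1 h2 ⊢ <;>
      rcases h1 with rfl | rfl <;> first | rfl | exact absurd hd h2
  have e1 := h.fwd (.in1_right g) h₁
  have e2 := h.fwd (.in1_left g) h₁
  have e3 := h.fwd (.in2_three g) h₂
  cases b₁
  · simp only [boolColor] at e1 e2
    have hl : ∀ d, M (.left g) d → d = 1 := fun d hd => by
      rcases h.allowed hd with rfl | rfl
      · exact absurd hd e2
      · rfl
    have hr : ∀ d, M (.right g) d → d = N := fun d hd => by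
      rcases h.allowed hd with rfl | rfl
      · exact absurd hd (h.bwd (.right_left g) hl)
      · rfl
    have hp : ∀ d, M (.pos g) d → d = 0 := fun d hd => by
      rcases h.allowed hd with rfl | ⟨rfl, -⟩
      · rfl
      · exact absurd hd (h.bwd (.pos_right g) hr)
    have ht : ∀ d, M (.three g) d → d = 1 := fun d hd => by
      rcases h.allowed hd with rfl | rfl | rfl
      · exact absurd hd (h.fwd (.pos_three g) hp)
      · rfl
      · exact absurd hd (h.bwd (.three_right g) hr)
    exact ⟨by simpa [gateColor] using ht, by simpa [gateColor] using hr,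
      by simpa [gateColor] using hl, by simpa [boolColor] using hp,
      hneg (by simpa [boolColor] using hp)⟩
  · simp only [boolColor] at e1 e2
    have hr : ∀ d, M (.right g) d → d = 1 := fun d hd => by
      rcases h.allowed hd with rfl | rfl
      · rfl
      · exact absurd hd e1
    have hl : ∀ d, M (.left g) d → d = 0 := fun d hd => by
      rcases h.allowed hd with rfl | rfl
      · rfl
      · exact absurd hd (h.fwd (.right_left g) hr)
    cases b₂
    · simp only [boolColor] at e3
      have ht : ∀ d, M (.three g) d → d = N := fun d hd => by
        rcases h.allowed hd with rfl | rfl | rfl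
        · exact absurd hd e3
        · exact absurd hd (h.bwd (.three_right g) hr)
        · rfl
      have hp : ∀ d, M (.pos g) d → d = 0 := fun d hd => by
        rcases h.allowed hd with rfl | ⟨rfl, -⟩
        · rfl
        · exact absurd hd (h.bwd (.pos_three g) ht)
      exact ⟨by simpa [gateColor] using ht, by simpa [gateColor] using hr,
        by simpa [gateColor] using hl, by simpa [boolColor] using hp,
        hneg (by simpa [boolColor] using hp)⟩
    · simp only [boolColor] at e3
      have ht : ∀ d, M (.three g) d → d = 0 := fun d hd => by
        rcases h.allowed hd with rfl | rfl | rfl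
        · rfl
        · exact absurd hd (h.bwd (.three_right g) hr)
        · exact absurd hd e3
      have hp : ∀ d, M (.pos g) d → d = N := fun d hd => by
        rcases h.allowed hd with rfl | ⟨rfl, -⟩
        · exact absurd hd (h.bwd (.pos_three g) ht)
        · rfl
      exact ⟨by simpa [gateColor] using ht, by simpa [gateColor] using hr,
        by simpa [gateColor] using hl, by simpa [boolColor] using hp,
        hneg (by simpa [boolColor] using hp)⟩

/-- Direct forcing evaluates every gate. -/
theorem gateForced_of_rank (h : D.Closed a M) (hN : 2 ≤ N) (rank : Γ → ℕ)
    (hr₁ : ∀ g, (D.in1 g).Below rank (rank g)) (hr₂ : ∀ g, (D.in2 g).Below rank (rank g))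
    {val : Γ → Bool} (hval : ∀ g, val g = ((D.in1 g).val a val && (D.in2 g).val a val)) (g : Γ) :
    GateForced M g ((D.in1 g).val a val) ((D.in2 g).val a val) := by
  induction hk : rank g using Nat.strong_induction_on generalizing g with
  | _ k ih =>
    subst hk
    have key : ∀ w : Wire p N Γ, w.Below rank (rank g) →
        ∀ d, M (w.vtx q) d → d = boolColor N (w.val a val) := by
      intro w hw d hd
      cases w with
      | one => simpa [Wire.val, boolColor] using h.ref _ _ hd
      | le j i => exact (h.cutForced_of_top hN (h.input j) i).2.2.2.1 d hd
      | gt j i => exact (h.cutForced_of_top hN (h.input j) i).2.2.2.2 d hd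
      | pos g' =>
        have := (ih _ hw g' rfl).2.2.2.1 d hd
        rw [← hval g'] at this
        exact this
      | neg g' =>
        have := (ih _ hw g' rfl).2.2.2.2 d hd
        rw [← hval g'] at this
        exact this
    exact h.gateForced hN (key _ (hr₁ g)) (key _ (hr₂ g))

/-- An empty list spreads from a gate to the whole graph. -/
theorem forall_not_of_pos (h : D.Closed a M) (hN : 2 ≤ N) {g : Γ} (hg : ∀ d, ¬ M (.pos g) d)
    (z : Vtx p q N Γ) (d : ℕ) : ¬ M z d := by
  have spread : ∀ x y, (D.Edge x y ∨ D.Edge y x) → (∀ d, ¬ M x d) → ∀ d, ¬ M y d :=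
    fun x y hxy hx d => hxy.elim (fun e => h.fwd e fun d' hd' => absurd hd' (hx d'))
      fun e => h.bwd e fun d' hd' => absurd hd' (hx d')
  -- Color `1` is never allowed at `pos`, so emptiness passes to the reference vertex `1`, from
  -- there to the clique of all reference vertices, and then to every vertex that must avoid some
  -- color. Only `top`, `hi`, `lo` and `three` are reached through an edge of their gadget.
  have r1 := spread _ _ (.inr (.ref ⟨1, by omega⟩ (.pos g) (by simp [Allowed]; omega))) hg
  have r : ∀ c, ∀ d, ¬ M (.ref c) d := by
    intro c
    by_cases hc : (1 : ℕ) = c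
    · have : c = ⟨1, by omega⟩ := Fin.ext hc.symm
      rwa [this]
    · exact spread _ _ (.inl (.ref ⟨1, by omega⟩ (.ref c) (by simpa [Allowed] using hc))) r1
  have hz : ∀ z (c : ℕ), c ≤ N → ¬ D.Allowed z c → ∀ d, ¬ M z d := fun z c hc hz =>
    spread _ _ (.inl (.ref ⟨c, by omega⟩ z hz)) (r _)
  have hcut : ∀ t i, ∀ d, ¬ M (.cut t i) d := fun t i => by
    have := i.2
    by_cases hi : (i : ℕ) = 0
    · exact hz _ N le_rfl (by simp [Allowed]; omega)
    · exact hz _ 0 (by omega) (by simp [Allowed]; omega)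
  have hright : ∀ g, ∀ d, ¬ M (.right g) d := fun g =>
    hz _ 0 (by omega) (by simp [Allowed]; omega)
  revert d
  cases z with
  | ref c => exact r c
  | top t => exact spread _ _ (.inr (.top_cut t ⟨0, by omega⟩)) (hcut _ _)
  | cut t i => exact hcut t i
  | hi t i => exact spread _ _ (.inl (.cut_hi t i)) (hcut _ _)
  | lo t i => exact spread _ _ (.inl (.cut_lo t i)) (hcut _ _)
  | le t i => exact hz _ 1 (by omega) (by simp [Allowed]; omega)
  | gt t i => exact hz _ 1 (by omega) (by simp [Allowed]; omega)
  | three g => exact spread _ _ (.inr (.three_right g)) (hright g)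
  | right g => exact hright g
  | left g => exact hz _ N le_rfl (by simp [Allowed]; omega)
  | pos g => exact hz _ 1 (by omega) (by simp [Allowed]; omega)
  | neg g => exact hz _ 1 (by omega) (by simp [Allowed]; omega)

end Closed

/-! ### The coloring belonging to given gate values -/

/-- The colors of all vertices when the inputs and outputs have the colors `col` and the gates
have the values `val`. -/
def color (D : Circuit p q N Γ) (col : Fin p ⊕ Fin q → ℕ) (val : Γ → Bool) : Vtx p q N Γ → ℕ
  | .ref c => c
  | .top t => col t
  | .cut t i => if col t ≤ i then i + 1 else (i : ℕ)
  | .hi t i => if col t ≤ i then 0 else i + 1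
  | .lo t i => if col t ≤ i then (i : ℕ) else N
  | .le t i => boolColor N (decide (col t ≤ i))
  | .gt t i => boolColor N (decide (i < col t))
  | .three g => (Closed.gateColor N ((D.in1 g).val (fun j => col (.inl j)) val)
      ((D.in2 g).val (fun j => col (.inl j)) val)).1
  | .right g => (Closed.gateColor N ((D.in1 g).val (fun j => col (.inl j)) val)
      ((D.in2 g).val (fun j => col (.inl j)) val)).2.1
  | .left g => (Closed.gateColor N ((D.in1 g).val (fun j => col (.inl j)) val)
      ((D.in2 g).val (fun j => col (.inl j)) val)).2.2
  | .pos g => boolColor N (val g)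
  | .neg g => boolColor N (!val g)

variable {col : Fin p ⊕ Fin q → ℕ} {val : Γ → Bool}

theorem color_vtx (w : Wire p N Γ) :
    D.color col val (w.vtx q) = boolColor N (w.val (fun j => col (.inl j)) val) := by
  cases w <;> rfl

/-- Information flows from the input colors to their thresholds, through the gates by rank, over the
edges from `neg (D.out l i)` to the output thresholds, and from these to the output colors. The
vertex `neg` carries the negated bit, so its neighbor `le` receives the bit itself. -/
theorem Closed.eq_color {M : Vtx p q N Γ → ℕ → Prop} (h : D.Closed (fun j => col (.inl j)) M)
    (hN : 2 ≤ N) (hcol : ∀ t, col t ≤ N) (rank : Γ → ℕ)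
    (hr₁ : ∀ g, (D.in1 g).Below rank (rank g)) (hr₂ : ∀ g, (D.in2 g).Below rank (rank g))
    (hval : ∀ g, val g = ((D.in1 g).val (fun j => col (.inl j)) val &&
      (D.in2 g).val (fun j => col (.inl j)) val))
    (hout : ∀ l i, val (D.out l i) = decide (col (.inr l) ≤ i))
    (z : Vtx p q N Γ) (d : ℕ) (hd : M z d) : d = D.color col val z := by
  have hg := h.gateForced_of_rank hN rank hr₁ hr₂ hval
  have hcut : ∀ t i, Closed.CutForced M t i (col t) := by
    rintro (j | l) i
    · exact h.cutForced_of_top hN (h.input j) i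
    · refine h.cutForced_of_le hN fun d hd => ?_
      have hneg := (hg (D.out l i)).2.2.2.2
      rw [← hval, hout] at hneg
      have h1 := h.allowed hd
      have h2 := h.bwd (.le_neg l i) hneg
      simp only [Allowed, boolColor] at h1 h2 ⊢
      by_cases hk : col (.inr l) ≤ i
      · simp [hk] at h2 ⊢
        rcases h1 with rfl | rfl
        · exact absurd hd h2
        · rfl
      · simp [hk] at h2 ⊢
        rcases h1 with rfl | rfl
        · rfl
        · exact absurd hd h2
  have htop : ∀ t, ∀ d, M (.top t) d → d = col t := fun t =>
    h.top_of_cutForced (hcol t) (hcut t)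
  revert d
  cases z with
  | ref c => exact h.ref c
  | top t => exact htop t
  | cut t i => exact (hcut t i).1
  | hi t i => exact (hcut t i).2.1
  | lo t i => exact (hcut t i).2.2.1
  | le t i => exact (hcut t i).2.2.2.1
  | gt t i => exact (hcut t i).2.2.2.2
  | three g => exact (hg g).1
  | right g => exact (hg g).2.1
  | left g => exact (hg g).2.2.1
  | pos g => simpa [color, ← hval] using (hg g).2.2.2.1
  | neg g =>
    have := (hg g).2.2.2.2
    rw [← hval] at this
    exact this

theorem allowed_color (hbad : ∀ g, D.bad g → val g = false) (z : Vtx p q N Γ) :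
    D.Allowed z (D.color col val z) := by
  cases z with
  | pos g =>
    by_cases hg : D.bad g
    · simp [Allowed, color, hbad g hg, boolColor]
    · cases h : val g <;> simp [Allowed, color, h, boolColor, hg]
  | ref c => rfl
  | top t => trivial
  | _ =>
    simp only [Allowed, color, Closed.gateColor, boolColor]
    split_ifs <;> simp

theorem color_ne (hN : 2 ≤ N)
    (hval : ∀ g, val g = ((D.in1 g).val (fun j => col (.inl j)) val &&
      (D.in2 g).val (fun j => col (.inl j)) val))
    (hout : ∀ l i, val (D.out l i) = decide (col (.inr l) ≤ i))
    (hbad : ∀ g, D.bad g → val g = false) {x y : Vtx p q N Γ} (e : D.Edge x y) :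
    D.color col val x ≠ D.color col val y := by
  have hal := allowed_color (col := col) hbad
  cases e with
  | ref c z hz =>
    intro h
    have := hal y
    rw [← h] at this
    exact hz this
  | in1_right g =>
    rw [color_vtx]
    simp only [color]
    generalize (D.in1 g).val _ _ = b₁
    cases b₁ <;> simp [boolColor, Closed.gateColor] <;> omega
  | in1_left g =>
    rw [color_vtx]
    simp only [color]
    generalize (D.in1 g).val _ _ = b₁
    cases b₁ <;> simp [boolColor, Closed.gateColor]
    omega
  | in2_three g =>
    rw [color_vtx]
    simp only [color]
    generalize (D.in1 g).val _ _ = b₁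
    generalize (D.in2 g).val _ _ = b₂
    cases b₁ <;> cases b₂ <;> simp [boolColor, Closed.gateColor] <;> omega
  | le_neg l i =>
    simp only [color, hout]
    by_cases hk : col (.inr l) ≤ i <;> simp [hk, boolColor] <;> omega
  | top_cut t i | cut_cut t i j h | cut_hi t i | hi_le t i | cut_lo t i | lo_le t i | le_gt t i =>
    have := i.2
    simp only [color, boolColor, decide_eq_true_eq]
    split_ifs <;> omega
  | _ g =>
    simp only [color, hval g]
    generalize (D.in1 g).val _ _ = b₁
    generalize (D.in2 g).val _ _ = b₂
    cases b₁ <;> cases b₂ <;> simp [boolColor, Closed.gateColor] <;> omega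

end Circuit

end GraphSim
namespace GraphSim

variable {p q N : ℕ} {Γ : Type}

/-! ### The marked graph of a circuit -/

/-- The parts of the vertex set of the graph of a circuit. -/
def Vtx.code : Vtx p q N Γ →
    Fin (N + 1) ⊕ (Fin p ⊕ Fin q) ⊕ (Fin 5 × (Fin p ⊕ Fin q) × Fin N) ⊕ (Fin 5 × Γ)
  | ref c => .inl c
  | top t => .inr (.inl t)
  | cut t i => .inr (.inr (.inl (0, t, i)))
  | hi t i => .inr (.inr (.inl (1, t, i)))
  | lo t i => .inr (.inr (.inl (2, t, i)))
  | le t i => .inr (.inr (.inl (3, t, i)))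
  | gt t i => .inr (.inr (.inl (4, t, i)))
  | three g => .inr (.inr (.inr (0, g)))
  | right g => .inr (.inr (.inr (1, g)))
  | left g => .inr (.inr (.inr (2, g)))
  | pos g => .inr (.inr (.inr (3, g)))
  | neg g => .inr (.inr (.inr (4, g)))

theorem Vtx.code_injective : Function.Injective (code : Vtx p q N Γ → _) := by
  intro x y h
  cases x <;> cases y <;> simp [code] at h <;> simp [h]

instance [Finite Γ] : Finite (Vtx p q N Γ) := Finite.of_injective _ Vtx.code_injective

theorem Vtx.card_le [Finite Γ] : Nat.card (Vtx p q N Γ) ≤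
    (N + 1) + ((p + q) + (5 * ((p + q) * N) + 5 * Nat.card Γ)) := by
  refine (Nat.card_le_card_of_injective _ Vtx.code_injective).trans (le_of_eq ?_)
  simp [Nat.card_sum, Nat.card_prod]

namespace Circuit

/-- A numbering of the vertices. -/
noncomputable def vtxEquiv (p q N : ℕ) (Γ : Type) [Finite Γ] :
    Vtx p q N Γ ≃ Fin (Nat.card (Vtx p q N Γ)) := Finite.equivFin _

/-- The marked graph of a circuit. -/
noncomputable def marked [Finite Γ] (D : Circuit p q N Γ) : MarkedGraph p q (N + 1) where
  ν := Nat.card (Vtx p q N Γ)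
  graph := D.graph.comap (vtxEquiv p q N Γ).symm
  x j := vtxEquiv p q N Γ (.top (.inl j))
  y l := vtxEquiv p q N Γ (.top (.inr l))
  r c := vtxEquiv p q N Γ (.ref c)
  xr_injective := by
    rintro (j | c) (j' | c') h <;> simp at h ⊢ <;> exact h
  y_injective := fun l l' h => by simpa using h

variable [Finite Γ] {D : Circuit p q N Γ}

/-- The reference vertices form a clique, since each of them must avoid the colors of all others. -/
theorem marked_ref_injective (σ : D.marked.graph.Coloring (Fin (N + 1))) :
    Function.Injective fun i => σ (D.marked.r i) := by
  intro c d h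
  by_contra hcd
  refine σ.valid ?_ h
  have : D.Edge (.ref c) (.ref d) :=
    .ref c _ fun h => hcd (Fin.ext h)
  simpa [marked] using this.adj

/-- Passage from lists of `Fin` colors on numbered vertices to predicates on `Vtx`, where the
gadgets can be handled by cases and arithmetic of natural numbers. -/
theorem closed_of_stable {a : Fin p → Fin (N + 1)}
    {L : Fin D.marked.ν → Finset (Fin (N + 1))} (hL : Stable D.marked.graph L)
    (hle : L ≤ D.marked.initialLists a) :
    D.Closed (fun j => a j)
      fun z c => ∃ h : c < N + 1, (⟨c, h⟩ : Fin (N + 1)) ∈ L (vtxEquiv p q N Γ z) where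
  color_le z c h := by obtain ⟨h, -⟩ := h; omega
  ref c d h := by
    obtain ⟨h, hd⟩ := h
    have := hle _ hd
    simp only [MarkedGraph.initialLists, Finset.mem_filter] at this
    simpa [Fin.ext_iff] using this.2.2 c rfl
  input j d h := by
    obtain ⟨h, hd⟩ := h
    have := hle _ hd
    simp only [MarkedGraph.initialLists, Finset.mem_filter] at this
    simpa [Fin.ext_iff] using this.2.1 j rfl
  adj x y c hxy hx := by
    rintro ⟨h, hc⟩
    refine hL (vtxEquiv p q N Γ x) (vtxEquiv p q N Γ y) ⟨c, h⟩ ?_ ?_ hc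
    · simpa [marked] using hxy
    · intro d hd
      have := hx d ⟨d.2, hd⟩
      simp [Fin.ext_iff, this]

/-- If the bad gates are false, then direct forcing finds a proper coloring. -/
theorem marked_found (hN : 2 ≤ N) (a : Fin p → Fin (N + 1)) (w : Fin q → Fin (N + 1))
    (rank : Γ → ℕ) (hr₁ : ∀ g, (D.in1 g).Below rank (rank g))
    (hr₂ : ∀ g, (D.in2 g).Below rank (rank g)) {val : Γ → Bool}
    (hval : ∀ g, val g = ((D.in1 g).val (fun j => a j) val && (D.in2 g).val (fun j => a j) val))
    (hout : ∀ l i, val (D.out l i) = decide ((w l : ℕ) ≤ i))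
    (hbad : ∀ g, D.bad g → val g = false) :
    ∃ σ : D.marked.graph.Coloring (Fin (N + 1)), D.marked.Extends a σ ∧
      (∀ l, σ (D.marked.y l) = w l) ∧
      ∀ L, Stable D.marked.graph L → L ≤ D.marked.initialLists a → L ≤ fun z => {σ z} := by
  set col : Fin p ⊕ Fin q → ℕ := Sum.elim (fun j => a j) (fun l => w l) with hcol
  have hcolN : ∀ t, col t < N + 1 := by rintro (j | l) <;> simp [hcol] <;> omega
  have hlt : ∀ z, D.color col val z < N + 1 := by
    intro z
    cases z with
    | top t => exact hcolN t
    | ref c => exact c.2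
    | cut t i | hi t i | lo t i =>
      have := i.2
      simp only [color]
      split_ifs <;> omega
    | _ =>
      simp only [color, boolColor, Closed.gateColor]
      split_ifs <;> omega
  let σ : D.marked.graph.Coloring (Fin (N + 1)) := SimpleGraph.Coloring.mk
    (fun z => ⟨D.color col val ((vtxEquiv p q N Γ).symm z), hlt _⟩) (by
      intro u v huv h
      simp only [Fin.mk.injEq] at h
      rcases ((SimpleGraph.fromRel_adj _ _ _).1 huv).2 with e | e
      · exact color_ne hN hval hout hbad e h
      · exact color_ne hN hval hout hbad e h.symm)
  have hσ : ∀ z, σ (vtxEquiv p q N Γ z) = ⟨D.color col val z, hlt _⟩ := fun z =>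
    Fin.ext (congrArg (D.color col val) ((vtxEquiv p q N Γ).symm_apply_apply z))
  refine ⟨σ, ⟨fun j => ?_, fun c => ?_⟩, fun l => ?_, fun L hL hle z c hc => ?_⟩
  · exact (hσ _).trans (Fin.ext rfl)
  · exact (hσ _).trans (Fin.ext rfl)
  · exact (hσ _).trans (Fin.ext rfl)
  · obtain ⟨z, rfl⟩ := (vtxEquiv p q N Γ).surjective z
    have := (closed_of_stable hL hle).eq_color (col := col) hN
      (fun t => Nat.lt_succ_iff.1 (hcolN t)) rank hr₁ hr₂ hval hout z c ⟨c.2, hc⟩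
    rw [Finset.mem_singleton, hσ]
    exact Fin.ext this

/-- If a bad gate is true, then direct forcing empties all lists. -/
theorem marked_none (hN : 2 ≤ N) (a : Fin p → Fin (N + 1))
    (rank : Γ → ℕ) (hr₁ : ∀ g, (D.in1 g).Below rank (rank g))
    (hr₂ : ∀ g, (D.in2 g).Below rank (rank g)) {val : Γ → Bool}
    (hval : ∀ g, val g = ((D.in1 g).val (fun j => a j) val && (D.in2 g).val (fun j => a j) val))
    {g : Γ} (hbad : D.bad g) (hg : val g = true)
    (L : Fin D.marked.ν → Finset (Fin (N + 1))) (hL : Stable D.marked.graph L)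
    (hle : L ≤ D.marked.initialLists a) : L = fun _ => ∅ := by
  have hc := closed_of_stable hL hle
  funext z
  obtain ⟨z, rfl⟩ := (vtxEquiv p q N Γ).surjective z
  rw [Finset.eq_empty_iff_forall_notMem]
  intro c hcz
  refine hc.forall_not_of_pos hN (g := g) (fun d hd => ?_) z c ⟨c.2, hcz⟩
  -- The true gate leaves only `N` at `pos`, but a bad gate does not allow `N`.
  have h1 := (hc.gateForced_of_rank hN rank hr₁ hr₂ hval g).2.2.2.1 d hd
  rw [← hval g, hg] at h1
  have h2 := hc.allowed hd
  simp [boolColor] at h1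
  simp [Allowed, hbad] at h2
  omega

end Circuit

/-! ### The circuit of a table -/

namespace Table

/-- The gates that look up a table: for every row `s` a chain that compares the input with `s`,
and for every output and every threshold a chain through all rows. -/
abbrev Gate (p q N : ℕ) : Type :=
  (Fin p → Fin (N + 1)) × Fin (p * N) ⊕ (Fin q × Fin N) × Fin ((N + 1) ^ p)

/-- The source that continues a chain of gates. -/
def prev {k : ℕ} (c : Fin k → Γ) (i : Fin k) : Wire p N Γ :=
  if (i : ℕ) = 0 then .one else .pos (c ⟨i - 1, by omega⟩)

theorem prev_below {k : ℕ} (c : Fin k → Γ) (i : Fin k) (rank : Γ → ℕ)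
    (h : ∀ i j, i < j → rank (c i) < rank (c j)) :
    (prev c i : Wire p N Γ).Below rank (rank (c i)) := by
  unfold prev
  split_ifs with h0
  · trivial
  · exact h _ _ (Fin.lt_def.2 (by simp; omega))

/-- A chain of gates computes running conjunctions; at its first place the empty conjunction is
supplied by the constant `one`. -/
theorem decide_forall_le {k : ℕ} (c : Fin k → Γ) (P : Fin k → Prop) (val : Γ → Bool)
    (a : Fin p → ℕ) [DecidablePred P]
    (hc : ∀ i, val (c i) = decide (∀ i' ≤ i, P i')) (i : Fin k) :
    decide (∀ i' ≤ i, P i') = ((prev c i : Wire p N Γ).val a val && decide (P i)) := by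
  unfold prev
  split_ifs with h0
  · have : ∀ i' ≤ i, i' = i := fun i' hi => Fin.ext (by have := Fin.le_def.1 hi; omega)
    simp only [Wire.val, Bool.true_and, decide_eq_decide]
    exact ⟨fun h => h i le_rfl, fun h i' hi => this i' hi ▸ h⟩
  · simp only [Wire.val, hc, ← Bool.decide_and, decide_eq_decide]
    refine ⟨fun h => ⟨fun i' hi => h i' (hi.trans (Fin.le_def.2 (by simp))), h i le_rfl⟩,
      fun h i' hi => ?_⟩
    rcases eq_or_ne i' i with rfl | hne
    · exact h.2
    · refine h.1 i' (Fin.le_def.2 ?_)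
      have := Fin.val_ne_of_ne hne
      have := Fin.le_def.1 hi
      simp
      omega

/-- The literal at a place of the chain that compares the input with the row `s`. -/
def literal (s : Fin p → Fin (N + 1)) (k : Fin (p * N)) : Wire p N (Gate p q N) :=
  let ji := finProdFinEquiv.symm k
  if (s ji.1 : ℕ) ≤ ji.2 then .le ji.1 ji.2 else .gt ji.1 ji.2

/-- The input `a` agrees with the row `s` at a place. -/
def Agrees (a s : Fin p → Fin (N + 1)) (k : Fin (p * N)) : Prop :=
  (s (finProdFinEquiv.symm k).1 : ℕ) ≤ (finProdFinEquiv.symm k).2 ↔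
    (a (finProdFinEquiv.symm k).1 : ℕ) ≤ (finProdFinEquiv.symm k).2

/-- Two different colors are separated by the threshold equal to the smaller one, which is below
`N`. -/
theorem forall_agrees_iff (a s : Fin p → Fin (N + 1)) : (∀ k, Agrees a s k) ↔ s = a := by
  constructor
  · intro h
    have h' : ∀ (j : Fin p) (i : Fin N), (s j : ℕ) ≤ i ↔ (a j : ℕ) ≤ i := fun j i => by
      simpa [Agrees] using h (finProdFinEquiv (j, i))
    funext j
    have hs := (s j).2
    have ha := (a j).2
    by_contra hne
    rcases lt_or_gt_of_ne (Fin.val_ne_of_ne hne) with hlt | hlt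
    · have := (h' j ⟨s j, by omega⟩).1 le_rfl
      simp at this
      omega
    · have := (h' j ⟨a j, by omega⟩).2 le_rfl
      simp at this
      omega
  · rintro rfl k
    exact Iff.rfl

/-- The row with a given number. -/
def row (k : Fin ((N + 1) ^ p)) : Fin p → Fin (N + 1) := finFunctionFinEquiv.symm k

/-- The row `s` of the table `f` has an entry `l` greater than `i`. -/
def Exceeds (f : (Fin p → Fin (N + 1)) → Option (Fin q → Fin (N + 1)))
    (l : Fin q) (i : Fin N) (s : Fin p → Fin (N + 1)) : Prop :=
  ∃ w, f s = some w ∧ (i : ℕ) < w l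

/-- The last gate of the chain for the row `s`. -/
def isRow (hpN : 0 < p * N) (s : Fin p → Fin (N + 1)) : Gate p q N :=
  .inl (s, ⟨p * N - 1, by omega⟩)

open Classical in
/-- The circuit that looks up the table `f`. -/
noncomputable def circuit (hpN : 0 < p * N)
    (f : (Fin p → Fin (N + 1)) → Option (Fin q → Fin (N + 1))) : Circuit p q N (Gate p q N) where
  in1
    | .inl (s, k) => prev (fun k => .inl (s, k)) k
    | .inr (li, k) => prev (fun k => .inr (li, k)) k
  in2
    | .inl (s, k) => literal s k
    | .inr ((l, i), k) => if Exceeds f l i (row k) then .neg (isRow hpN (row k)) else .one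
  out l i := .inr ((l, i), ⟨(N + 1) ^ p - 1, Nat.sub_lt (by positivity) one_pos⟩)
  bad g := ∃ s, f s = none ∧ g = isRow hpN s

/-- The depth of a gate. -/
def rank : Gate p q N → ℕ
  | .inl (_, k) => k
  | .inr (_, k) => p * N + k

open Classical in
/-- The values of the gates on the input `a`. -/
noncomputable def value (f : (Fin p → Fin (N + 1)) → Option (Fin q → Fin (N + 1)))
    (a : Fin p → Fin (N + 1)) : Gate p q N → Bool
  | .inl (s, k) => decide (∀ k' ≤ k, Agrees a s k')
  | .inr ((l, i), k) => decide (∀ k' ≤ k, ¬ (Exceeds f l i (row k') ∧ row k' = a))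

variable {hpN : 0 < p * N} {f : (Fin p → Fin (N + 1)) → Option (Fin q → Fin (N + 1))}

theorem value_isRow (a s : Fin p → Fin (N + 1)) :
    value f a (isRow hpN s) = true ↔ s = a := by
  rw [← forall_agrees_iff]
  simp only [value, isRow, decide_eq_true_eq]
  exact ⟨fun h k => h k (Fin.le_def.2 (by simp; omega)), fun h k _ => h k⟩

/-- The last gate of the chain has seen all rows, and the only row that is recognized is `a` itself.
-/
theorem value_out (a : Fin p → Fin (N + 1)) (w : Fin q → Fin (N + 1)) (hw : f a = some w)
    (l : Fin q) (i : Fin N) :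
    value f a ((circuit hpN f).out l i) = decide ((w l : ℕ) ≤ i) := by
  simp only [value, circuit, decide_eq_decide]
  constructor
  · intro h
    by_contra hlt
    refine h (finFunctionFinEquiv a) (Nat.le_sub_one_of_lt (finFunctionFinEquiv a).2) ?_
    have : row (finFunctionFinEquiv a) = a := by simp [row]
    rw [this]
    exact ⟨⟨w, hw, by omega⟩, rfl⟩
  · rintro h k - ⟨⟨w', hw', hlt⟩, rfl⟩
    rw [hw] at hw'
    cases hw'
    omega

theorem value_eq (a : Fin p → Fin (N + 1)) (g : Gate p q N) :
    value f a g = (((circuit hpN f).in1 g).val (fun j => a j) (value f a) &&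
      ((circuit hpN f).in2 g).val (fun j => a j) (value f a)) := by
  classical
  rcases g with ⟨s, k⟩ | ⟨⟨l, i⟩, k⟩
  · have : ((circuit hpN f).in2 (.inl (s, k))).val (fun j => a j) (value f a) =
        decide (Agrees a s k) := by
      simp only [circuit, literal, Agrees]
      split_ifs with h
      · simp only [Wire.val, h, true_iff]
      · simp only [Wire.val, h, false_iff, not_le]
    rw [this]
    simp only [value]
    exact decide_forall_le (N := N) (fun k => Sum.inl (s, k)) (Agrees a s) (value f a)
      (fun j => (a j : ℕ)) (fun k => by simp only [value]) k
  · have : ((circuit hpN f).in2 (.inr ((l, i), k))).val (fun j => a j) (value f a) =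
        decide (¬ (Exceeds f l i (row k) ∧ row k = a)) := by
      simp only [circuit]
      have h2 := value_isRow (f := f) (hpN := hpN) a (row k)
      split_ifs with h
      · by_cases hk : row k = a
        · have hv := h2.2 hk
          rw [hk] at h hv
          simp [Wire.val, hk, h, hv]
        · have : value f a (isRow hpN (row k)) = false := by simpa [hk] using h2
          simp [Wire.val, hk, this]
      · simp [Wire.val, h]
    rw [this]
    simp only [value]
    exact decide_forall_le (N := N) (fun k => Sum.inr ((l, i), k))
      (fun k => ¬ (Exceeds f l i (row k) ∧ row k = a)) (value f a) (fun j => (a j : ℕ))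
      (fun k => by simp only [value]) k

theorem in1_below (g : Gate p q N) : ((circuit hpN f).in1 g).Below rank (rank g) := by
  rcases g with ⟨s, k⟩ | ⟨li, k⟩
  · exact prev_below (fun k => Sum.inl (s, k)) k rank fun i j h => h
  · exact prev_below (fun k => Sum.inr (li, k)) k rank fun i j h => by
      simpa [rank] using h

/-- Row chains have ranks below `p * N` and output chains start at `p * N`, so outputs may read
every row test. -/
theorem in2_below (g : Gate p q N) : ((circuit hpN f).in2 g).Below rank (rank g) := by
  rcases g with ⟨s, k⟩ | ⟨⟨l, i⟩, k⟩
  · simp only [circuit, literal]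
    split_ifs <;> trivial
  · simp only [circuit]
    split_ifs
    · simp [Wire.Below, isRow, rank]
      omega
    · trivial

theorem card_gate : Nat.card (Gate p q N) = (N + 1) ^ p * (p * N) + q * N * (N + 1) ^ p := by
  simp [Gate]

theorem marked_card_le (hp : 1 ≤ p) :
    (circuit hpN f).marked.ν ≤ 12 * ((p + q) * (N + 1) ^ (p + 1)) := by
  refine (Vtx.card_le (p := p) (q := q) (N := N) (Γ := Gate p q N)).trans ?_
  rw [card_gate]
  have h1 : 1 ≤ (N + 1) ^ p := Nat.one_le_pow _ _ (by omega)
  rw [pow_succ]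
  set P := (N + 1) ^ p
  have h2 : (p + q) * (N + 1) ≤ (p + q) * (P * (N + 1)) :=
    Nat.mul_le_mul_left _ (Nat.le_mul_of_pos_left _ h1)
  have h3 : N + 1 ≤ (p + q) * (N + 1) := Nat.le_mul_of_pos_left _ (by omega)
  have h4 : P * (p * N) + q * N * P = (p + q) * (P * N) := by ring
  have h5 : (p + q) * (P * N) ≤ (p + q) * (P * (N + 1)) := by gcongr; omega
  have h6 : (p + q) * (N + 1) = (p + q) * N + (p + q) := by ring
  rw [h4]
  omega

end Table

/-- Every table is looked up by direct forcing on a marked graph of moderate size. -/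
theorem exists_markedGraph (hp : 1 ≤ p) (hN : 2 ≤ N)
    (f : (Fin p → Fin (N + 1)) → Option (Fin q → Fin (N + 1))) :
    ∃ M : MarkedGraph p q (N + 1), M.ν ≤ 12 * ((p + q) * (N + 1) ^ (p + 1)) ∧
      (∀ σ : M.graph.Coloring (Fin (N + 1)), Function.Injective fun i => σ (M.r i)) ∧
      (∀ a w, f a = some w → ∃ σ : M.graph.Coloring (Fin (N + 1)), M.Extends a σ ∧
        (∀ l, σ (M.y l) = w l) ∧
        ∀ L, Stable M.graph L → L ≤ M.initialLists a → L ≤ fun z => {σ z}) ∧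
      (∀ a, f a = none → ∀ L, Stable M.graph L → L ≤ M.initialLists a → L = fun _ => ∅) := by
  have hpN : 0 < p * N := Nat.mul_pos hp (by omega)
  refine ⟨(Table.circuit hpN f).marked, Table.marked_card_le hp, Circuit.marked_ref_injective,
    fun a w hw => Circuit.marked_found hN a w Table.rank Table.in1_below Table.in2_below
      (Table.value_eq a) (Table.value_out a w hw) ?_,
    fun a ha => Circuit.marked_none hN a Table.rank Table.in1_below Table.in2_below
      (Table.value_eq a) (g := Table.isRow hpN a) ⟨a, ha, rfl⟩
      ((Table.value_isRow a a).2 rfl)⟩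
  -- A bad gate tests a row without entry; were it true, this row would be `a`, which has an entry.
  rintro g ⟨s, hs, rfl⟩
  by_contra h
  have := (Table.value_isRow (f := f) (hpN := hpN) a s).1 (by simpa using h)
  rw [← this, hs] at hw
  cases hw

end GraphSim
namespace GraphSim

variable {p q m n N : ℕ}

/-! ### Simulation of partial functions -/

/-- The link from colorings to forcing: an extension is a stable family of singletons, and so lies
below the normal form. -/
theorem MarkedGraph.Extends.stable {M : MarkedGraph p q n} {a : Fin p → Fin n}
    {σ : M.graph.Coloring (Fin n)} (h : M.Extends a σ) :
    Stable M.graph (fun z => {σ z}) ∧ (fun z => {σ z}) ≤ M.initialLists a := by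
  refine ⟨fun u v c huv hu hv => ?_, fun z c hc => ?_⟩
  · rw [Finset.singleton_subset_iff, Finset.mem_singleton] at hu
    rw [Finset.mem_singleton] at hv
    exact σ.valid huv (hu.trans hv)
  · rw [Finset.mem_singleton] at hc
    subst hc
    simp only [initialLists, Finset.mem_filter, Finset.mem_univ, true_and]
    exact ⟨fun j hj => hj ▸ h.1 j, fun i hi => hi ▸ h.2 i⟩

theorem ncard_edgeSet_le {ν : ℕ} (G : SimpleGraph (Fin ν)) : G.edgeSet.ncard ≤ ν ^ 2 := by
  classical
  rw [Set.ncard_eq_toFinset_card']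
  refine (SimpleGraph.card_edgeFinset_le_card_choose_two (G := G)).trans ?_
  simpa using Nat.choose_le_pow ν 2

open Classical in
/-- The table of a partial function. -/
noncomputable def table (h : m ≤ n) (φ : (Fin p → Fin m) →. (Fin q → Fin m))
    (a : Fin p → Fin n) : Option (Fin q → Fin n) :=
  if hs : ∃ s ∈ φ.Dom, ∀ j, (s j : ℕ) = a j then
    some fun l => Fin.castLE h ((φ hs.choose).get hs.choose_spec.1 l)
  else none

/-- The chosen preimage of `a` must be `s`, because the inclusion of `S` into the colors is
injective. -/
theorem table_eq_some {h : m ≤ n} {φ : (Fin p → Fin m) →. (Fin q → Fin m)} {a : Fin p → Fin n}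
    {s : Fin p → Fin m} {w : Fin q → Fin m} (hs : ∀ j, (s j : ℕ) = a j) (hw : w ∈ φ s) :
    table h φ a = some fun l => Fin.castLE h (w l) := by
  have hex : ∃ s ∈ φ.Dom, ∀ j, (s j : ℕ) = a j := ⟨s, Part.dom_iff_mem.2 ⟨w, hw⟩, hs⟩
  have heq : hex.choose = s := by
    funext j
    exact Fin.ext ((hex.choose_spec.2 j).trans (hs j).symm)
  rw [table, dif_pos hex]
  congr 1
  funext l
  congr 1
  have : (φ hex.choose).get hex.choose_spec.1 ∈ φ hex.choose := Part.get_mem _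
  generalize (φ hex.choose).get hex.choose_spec.1 = w' at this
  rw [heq] at this
  rw [Part.mem_unique this hw]

theorem table_eq_none {h : m ≤ n} {φ : (Fin p → Fin m) →. (Fin q → Fin m)} {a : Fin p → Fin n} :
    table h φ a = none ↔ ¬ ∃ s ∈ φ.Dom, ∀ j, (s j : ℕ) = a j := by
  rw [table]
  split_ifs with hs
  · exact ⟨(fun h => nomatch h), fun h => absurd hs h⟩
  · exact ⟨fun _ => hs, fun _ => rfl⟩

/-- Squaring the vertex bound produces a second factor `p + q`, which is absorbed by `p + q ≤ n ^ (p
+ q)`; the exponent `3 * p + q + 2` is then small enough. -/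
theorem size_bounds {ν e Θ : ℕ} (hq : 1 ≤ q) (hn : 3 ≤ n)
    (hν : ν ≤ 12 * ((p + q) * n ^ (p + 1))) (he : e ≤ ν ^ 2) (hΘ : 1 ≤ Θ) :
    ν ≤ 144 * (Θ * (p + q) * n ^ (2 * (p + q) + 4)) ∧
      e ≤ 144 * (Θ * (p + q) * n ^ (3 * (p + q) + 5)) := by
  have hpq : p + q ≤ n ^ (p + q) :=
    (Nat.lt_pow_self (by omega : 1 < n)).le
  constructor
  · refine hν.trans (Nat.mul_le_mul (by norm_num) (Nat.mul_le_mul ?_ ?_))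
    · exact Nat.le_mul_of_pos_left _ hΘ
    · exact Nat.pow_le_pow_right (by omega) (by omega)
  · calc e ≤ ν ^ 2 := he
      _ ≤ (12 * ((p + q) * n ^ (p + 1))) ^ 2 := Nat.pow_le_pow_left hν 2
      _ = 144 * (1 * (p + q) * ((p + q) * n ^ (2 * p + 2))) := by ring
      _ ≤ 144 * (Θ * (p + q) * (n ^ (p + q) * n ^ (2 * p + 2))) := by gcongr
      _ = 144 * (Θ * (p + q) * n ^ (p + q + (2 * p + 2))) := by rw [← pow_add]
      _ ≤ 144 * (Θ * (p + q) * n ^ (3 * (p + q) + 5)) :=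
        Nat.mul_le_mul_left _ (Nat.mul_le_mul_left _
          (Nat.pow_le_pow_right (by omega) (by omega)))

/-- Every partial function is simulated by a marked graph on which direct forcing either finds
the extension or empties all lists. -/
theorem exists_simulates (hp : 1 ≤ p) (hq : 1 ≤ q) (hmn : max m 3 ≤ n)
    (φ : (Fin p → Fin m) →. (Fin q → Fin m)) :
    ∃ M : MarkedGraph p q n, M.Simulates φ ∧
      (∀ Θ : ℕ, 1 ≤ Θ →
        M.ν ≤ 144 * (Θ * (p + q) * n ^ (2 * (p + q) + 4)) ∧
        M.graph.edgeSet.ncard ≤ 144 * (Θ * (p + q) * n ^ (3 * (p + q) + 5))) ∧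
      ∀ a : Fin p → Fin n,
        (∃ σ : M.graph.Coloring (Fin n), M.Extends a σ ∧
          (∀ τ : M.graph.Coloring (Fin n), M.Extends a τ → τ = σ) ∧
          IsNormalForm M.graph (M.initialLists a) (fun z => {σ z})) ∨
        ((¬ ∃ σ : M.graph.Coloring (Fin n), M.Extends a σ) ∧
          IsNormalForm M.graph (M.initialLists a) (fun _ => ∅)) := by
  have hm : m ≤ n := (le_max_left _ _).trans hmn
  have hn : 3 ≤ n := (le_max_right _ _).trans hmn
  obtain ⟨N, rfl⟩ : ∃ N, n = N + 1 := ⟨n - 1, by omega⟩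
  obtain ⟨M, hν, href, hsome, hnone⟩ := exists_markedGraph hp (by omega) (table hm φ)
  have huniq : ∀ (a : Fin p → Fin (N + 1)) (σ τ : M.graph.Coloring (Fin (N + 1))),
      M.Extends a σ → M.Extends a τ → σ = τ := by
    intro a σ τ hσ hτ
    cases h : table hm φ a with
    | none =>
      -- Since `1 ≤ p` there is a vertex, where a singleton list would have to be empty.
      have := congrFun (hnone a h _ hσ.stable.1 hσ.stable.2) (M.x ⟨0, hp⟩)
      simp at this
    | some w =>
      obtain ⟨ρ, -, -, hρ⟩ := hsome a w h
      have key : ∀ τ, M.Extends a τ → τ = ρ := fun τ hτ => RelHom.ext fun z => by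
        simpa using hρ _ hτ.stable.1 hτ.stable.2 z
      rw [key σ hσ, key τ hτ]
  have hext : ∀ a : Fin p → Fin (N + 1), (∃ σ : M.graph.Coloring (Fin (N + 1)), M.Extends a σ) ↔
      table hm φ a ≠ none := by
    intro a
    constructor
    · rintro ⟨σ, hσ⟩ h
      have := congrFun (hnone a h _ hσ.stable.1 hσ.stable.2) (M.x ⟨0, hp⟩)
      simp at this
    · intro h
      obtain ⟨w, hw⟩ := Option.ne_none_iff_exists'.1 h
      obtain ⟨σ, hσ, -⟩ := hsome a w hw
      exact ⟨σ, hσ⟩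
  refine ⟨M, ⟨?_, href, fun a => ?_, huniq, ?_⟩, fun Θ hΘ => ?_, fun a => ?_⟩
  · rintro ⟨s, hs⟩
    obtain ⟨σ, -⟩ := (hext fun j => Fin.castLE hm (s j)).2
      (mt table_eq_none.1 (not_not.2 ⟨s, hs, fun j => rfl⟩))
    exact ⟨σ⟩
  · rw [hext, ne_eq, table_eq_none, not_not]
  · intro a σ hσ s w hs hw l
    obtain ⟨τ, hτ, hy, -⟩ := hsome a _ (table_eq_some hs hw)
    rw [huniq a σ τ hσ hτ, hy]
    rfl
  · exact size_bounds hq hn hν (ncard_edgeSet_le _) hΘ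
  · obtain ⟨L, hL⟩ := exists_isNormalForm M.graph (M.initialLists a)
    have hst := stable_of_irreducible hL.2
    have hle := le_of_reflTransGen hL.1
    cases h : table hm φ a with
    | none =>
      refine .inr ⟨fun hex => (hext a).1 hex h, ?_⟩
      rwa [hnone a h L hst hle] at hL
    | some w =>
      obtain ⟨σ, hσ, -, hmax⟩ := hsome a w h
      refine .inl ⟨σ, hσ, fun τ hτ => huniq a τ σ hτ hσ, ?_⟩
      rwa [hL.eq_of_greatest hσ.stable.1 hσ.stable.2 hmax] at hL

end GraphSim
namespace GraphSim

/-! ### Programs with bounded loops -/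

@[simp] theorem State.setReg_reg (s : State) (d v r : ℕ) :
    (s.setReg d v).reg r = if r = d then v else s.reg r := by
  simp [State.setReg, Function.update_apply]

@[simp] theorem State.setReg_arr (s : State) (d v : ℕ) : (s.setReg d v).arr = s.arr := rfl

@[simp] theorem State.setArr_reg (s : State) (k i v : ℕ) : (s.setArr k i v).reg = s.reg := rfl

@[simp] theorem State.setArr_arr (s : State) (k i v k' i' : ℕ) :
    (s.setArr k i v).arr k' i' = if k' = k ∧ i' = i then v else s.arr k' i' := by
  simp only [State.setArr, Function.update_apply]
  split_ifs <;> simp_all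

/-- Programs all of whose loops are executed exactly `reg 0` times. The registers `0`, `1` and `2`
are not written to; the last two hold `0` and `1`. -/
inductive BProg : Type
  | const (d c : ℕ) : BProg
  | add (d a b : ℕ) : BProg
  | sub (d a b : ℕ) : BProg
  | load (k d a : ℕ) : BProg
  | store (k a s : ℕ) : BProg
  | seq (P Q : BProg) : BProg
  | ite (c : ℕ) (P Q : BProg) : BProg
  /-- Execute `P` with `reg i = reg 0 - 1, …, 1, 0`. -/
  | rep (i : ℕ) (P : BProg) : BProg

namespace BProg

infixr:67 " ;; " => BProg.seq

/-- Iterate `f`, with the register `i` counting down from `k`. -/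
def iter (f : State → State) (i : ℕ) : ℕ → State → State
  | 0, s => s
  | k + 1, s => iter f i k (f (s.setReg i k))

/-- The state in which a program halts. -/
def run : BProg → State → State
  | const d c, s => s.setReg d c
  | add d a b, s => s.setReg d (s.reg a + s.reg b)
  | sub d a b, s => s.setReg d (s.reg a - s.reg b)
  | load k d a, s => s.setReg d (s.arr k (s.reg a))
  | store k a b, s => s.setArr k (s.reg a) (s.reg b)
  | seq P Q, s => Q.run (P.run s)
  | ite c P Q, s => if s.reg c = 0 then Q.run s else P.run s
  | rep i P, s => iter P.run i (s.reg 0) (s.setReg i (s.reg 0))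

/-- Translation to a program of the random access machine. -/
def toProg : BProg → Prog
  | const d c => .const d c
  | add d a b => .add d a b
  | sub d a b => .sub d a b
  | load k d a => .load k d a
  | store k a b => .store k a b
  | seq P Q => .seq P.toProg Q.toProg
  | ite c P Q => .ite c P.toProg Q.toProg
  | rep i P => .seq (.add i 0 1) (.loop i (.seq (.sub i i 2) P.toProg))

/-- The registers to which a program writes. -/
def regs : BProg → List ℕ
  | const d _ => [d]
  | add d _ _ => [d]
  | sub d _ _ => [d]
  | load _ d _ => [d]
  | store _ _ _ => []
  | seq P Q => P.regs ++ Q.regs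
  | ite _ P Q => P.regs ++ Q.regs
  | rep i P => i :: P.regs

/-- The arrays to which a program writes. -/
def arrs : BProg → List ℕ
  | store k _ _ => [k]
  | seq P Q => P.arrs ++ Q.arrs
  | ite _ P Q => P.arrs ++ Q.arrs
  | rep _ P => P.arrs
  | _ => []

/-- Whether the loops of a program leave their counters alone. -/
def loopsOk : BProg → Bool
  | seq P Q => P.loopsOk && Q.loopsOk
  | ite _ P Q => P.loopsOk && Q.loopsOk
  | rep i P => P.loopsOk && !(P.regs.contains i)
  | _ => true

/-- Whether a program stores nothing but `1` in the array `2`. -/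
def onlySets : BProg → Bool
  | store k _ s => k != 2 || s == 2
  | seq P Q => P.onlySets && Q.onlySets
  | ite _ P Q => P.onlySets && Q.onlySets
  | rep _ P => P.onlySets
  | _ => true

/-- A bound for the number of steps. -/
noncomputable def time : BProg → Polynomial ℕ
  | seq P Q => P.time + Q.time
  | ite _ P Q => P.time + Q.time + 1
  | rep _ P => Polynomial.X * (P.time + 2) + 2
  | _ => 1

/-! ### Semantics and running time of bounded programs -/

theorem iter_induction {f : State → State} {i : ℕ} (I : ℕ → State → Prop) {k : ℕ} {s : State}
    (h : I k s) (hf : ∀ j s, j < k → I (j + 1) s → I j (f (s.setReg i j))) :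
    I 0 (iter f i k s) := by
  induction k generalizing s with
  | zero => exact h
  | succ k ih => exact ih (hf k s (by omega) h) fun j s hj => hf j s (by omega)

/-- Frame rule: for a concrete program the hypothesis is settled by `decide`, so unaffected
registers need no evaluation of the program. -/
theorem run_reg {P : BProg} {r : ℕ} (hr : r ∉ P.regs) (s : State) :
    (P.run s).reg r = s.reg r := by
  induction P generalizing s with
  | seq P Q ihP ihQ =>
    simp only [regs, List.mem_append, not_or] at hr
    rw [run, ihQ hr.2, ihP hr.1]
  | ite c P Q ihP ihQ =>
    simp only [regs, List.mem_append, not_or] at hr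
    rw [run]
    split_ifs
    · exact ihQ hr.2 s
    · exact ihP hr.1 s
  | rep i P ih =>
    simp only [regs, List.mem_cons, not_or] at hr
    rw [run]
    exact iter_induction (fun _ s' => s'.reg r = s.reg r) (by simp [hr.1])
      fun j s' _ h => by simp [ih hr.2, hr.1, h]
  | _ => simp_all [regs, run]

theorem run_arr {P : BProg} {k : ℕ} (hk : k ∉ P.arrs) (s : State) :
    (P.run s).arr k = s.arr k := by
  induction P generalizing s with
  | seq P Q ihP ihQ =>
    simp only [arrs, List.mem_append, not_or] at hk
    rw [run, ihQ hk.2, ihP hk.1]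
  | ite c P Q ihP ihQ =>
    simp only [arrs, List.mem_append, not_or] at hk
    rw [run]
    split_ifs
    · exact ihQ hk.2 s
    · exact ihP hk.1 s
  | rep i P ih =>
    rw [run]
    exact iter_induction (fun _ s' => s'.arr k = s.arr k) rfl
      fun j s' _ h => by simp [ih hk, h]
  | store =>
    funext i
    simp_all [arrs, run]
  | _ => rfl

/-- Array `2` will hold the marks. Register `2` keeps the value `1`, and nothing else is stored
there, so a mark is never erased. -/
theorem run_arr_two_ne_zero {P : BProg} (h2 : 2 ∉ P.regs) (h : P.onlySets = true) {s : State}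
    (hs : s.reg 2 = 1) {x : ℕ} (hx : s.arr 2 x ≠ 0) : (P.run s).arr 2 x ≠ 0 := by
  induction P generalizing s with
  | seq P Q ihP ihQ =>
    simp only [regs, List.mem_append, not_or] at h2
    simp only [onlySets, Bool.and_eq_true] at h
    exact ihQ h2.2 h.2 ((run_reg h2.1 s).trans hs) (ihP h2.1 h.1 hs hx)
  | ite c P Q ihP ihQ =>
    simp only [regs, List.mem_append, not_or] at h2
    simp only [onlySets, Bool.and_eq_true] at h
    rw [run]
    split_ifs
    · exact ihQ h2.2 h.2 hs hx
    · exact ihP h2.1 h.1 hs hx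
  | rep i P ih =>
    simp only [regs, List.mem_cons, not_or] at h2
    rw [run]
    exact (iter_induction (fun _ s' => s'.reg 2 = 1 ∧ s'.arr 2 x ≠ 0)
      (by simp [h2.1, hs, hx]) fun j s' _ h' =>
        ⟨by simp [run_reg h2.2, h2.1, h'.1], ih h2.2 h (by simp [h2.1, h'.1]) h'.2⟩).2
  | store k a b =>
    simp only [run, State.setArr_arr]
    split_ifs with hc
    · obtain ⟨rfl, rfl⟩ := hc
      simp only [onlySets, bne_self_eq_false, Bool.false_or, beq_iff_eq] at h
      simp [h, hs]
    · exact hx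
  | _ => exact hx

/-- Register `0` never changes, so all loops, nested ones included, have the same length, and one
polynomial in it bounds the time. The translated loop decrements its counter before the body, which
therefore sees the values `reg 0 - 1, …, 0`. -/
theorem exec {P : BProg} (hok : P.loopsOk = true) (h0 : 0 ∉ P.regs) (h1 : 1 ∉ P.regs)
    (h2 : 2 ∉ P.regs) {s : State} (hs1 : s.reg 1 = 0) (hs2 : s.reg 2 = 1) :
    ∃ t ≤ P.time.eval (s.reg 0), Exec P.toProg s t (P.run s) := by
  induction P generalizing s with
  | seq P Q ihP ihQ =>
    simp only [regs, List.mem_append, not_or] at h0 h1 h2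
    simp only [loopsOk, Bool.and_eq_true] at hok
    obtain ⟨t, ht, e⟩ := ihP hok.1 h0.1 h1.1 h2.1 hs1 hs2
    obtain ⟨t', ht', e'⟩ := ihQ hok.2 h0.2 h1.2 h2.2 ((run_reg h1.1 s).trans hs1)
      ((run_reg h2.1 s).trans hs2)
    rw [run_reg h0.1] at ht'
    exact ⟨t + t', by simp [time]; omega, e.seq e'⟩
  | ite c P Q ihP ihQ =>
    simp only [regs, List.mem_append, not_or] at h0 h1 h2
    simp only [loopsOk, Bool.and_eq_true] at hok
    rw [run]
    split_ifs with hc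
    · obtain ⟨t, ht, e⟩ := ihQ hok.2 h0.2 h1.2 h2.2 hs1 hs2
      exact ⟨t + 1, by simp [time]; omega, .ite_false hc e⟩
    · obtain ⟨t, ht, e⟩ := ihP hok.1 h0.1 h1.1 h2.1 hs1 hs2
      exact ⟨t + 1, by simp [time]; omega, .ite_true hc e⟩
  | rep i P ih =>
    simp only [regs, List.mem_cons, not_or] at h0 h1 h2
    simp only [loopsOk, Bool.and_eq_true, Bool.not_eq_true', List.contains_eq_mem,
      decide_eq_false_iff_not] at hok
    have key : ∀ (k : ℕ) (s' : State), s'.reg 0 = s.reg 0 → s'.reg 1 = 0 → s'.reg 2 = 1 →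
        s'.reg i = k → ∃ t ≤ k * (P.time.eval (s.reg 0) + 2) + 1,
          Exec (.loop i (.seq (.sub i i 2) P.toProg)) s' t (iter P.run i k s') := by
      intro k
      induction k with
      | zero => exact fun s' _ _ _ hk => ⟨1, by omega, by constructor; exact hk⟩
      | succ k ihk =>
        intro s' e0 e1 e2 hk
        have hsub : Exec (.sub i i 2) s' 1 (s'.setReg i k) := by
          have := Exec.sub i i 2 s'
          rwa [hk, e2] at this
        obtain ⟨t, ht, e⟩ := ih (s := s'.setReg i k) hok.1 h0.2 h1.2 h2.2
          (by simp [h1.1, e1]) (by simp [h2.1, e2])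
        obtain ⟨t', ht', e'⟩ := ihk (P.run (s'.setReg i k)) (by simp [run_reg h0.2, h0.1, e0])
          (by simp [run_reg h1.2, h1.1, e1]) (by simp [run_reg h2.2, h2.1, e2])
          (by simp [run_reg hok.2])
        refine ⟨1 + t + t' + 1, ?_, .loop_step (by omega) (hsub.seq e) e'⟩
        simp [h0.1, e0] at ht
        rw [Nat.succ_mul]
        omega
    obtain ⟨t, ht, e⟩ := key (s.reg 0) (s.setReg i (s.reg 0)) (by simp [h0.1])
      (by simp [h1.1, hs1]) (by simp [h2.1, hs2]) (by simp)
    have hadd : Exec (.add i 0 1) s 1 (s.setReg i (s.reg 0)) := by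
      have := Exec.add i 0 1 s
      rwa [hs1, Nat.add_zero] at this
    refine ⟨1 + t, ?_, hadd.seq e⟩
    simp [time]
    omega
  | const => exact ⟨1, by simp [time], .const _ _ _⟩
  | add => exact ⟨1, by simp [time], .add _ _ _ _⟩
  | sub => exact ⟨1, by simp [time], .sub _ _ _ _⟩
  | load => exact ⟨1, by simp [time], .load _ _ _ _⟩
  | store => exact ⟨1, by simp [time], .store _ _ _ _⟩

/-! ### Loops over an initial segment of the indices -/

/-- Do nothing of importance. -/
def skip : BProg := const 41 0

/-- Execute `P` if `reg i < reg d`. -/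
def guard (d i : ℕ) (P : BProg) : BProg := sub 40 d i ;; ite 40 P skip

/-- Execute `P` for all values of `reg i` below `reg d`, which should be at most `reg 0`. -/
def forBelow (d i : ℕ) (P : BProg) : BProg := rep i (guard d i P)

/-- The loop counts down from `reg 0`, and the guard skips all indices from `b` on. `I k` speaks of
the moment when the indices `k, …, b - 1` are done; it must survive writes to the counter and to the
scratch registers `40` and `41`. -/
theorem forBelow_induction {d i : ℕ} {P : BProg} (I : ℕ → State → Prop) {b : ℕ} {s : State}
    (hb : b ≤ s.reg 0) (hd : s.reg d = b) (hdi : d ∉ i :: 40 :: 41 :: P.regs)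
    (hi : i ∉ [40, 41])
    (hset : ∀ k s r v, r ∈ [i, 40, 41] → I k s → I k (s.setReg r v))
    (h : I b s) (step : ∀ k s, k < b → I (k + 1) s → s.reg i = k → I k (P.run s)) :
    I 0 ((forBelow d i P).run s) := by
  simp only [List.mem_cons, not_or, List.not_mem_nil] at hdi hi
  obtain ⟨h1, h2, h3, h4⟩ := hdi
  have hset' : ∀ k s v, I k s → I k (s.setReg i v) ∧ I k (s.setReg 40 v) ∧ I k (s.setReg 41 v) :=
    fun k s v h => ⟨hset k s i v (by simp) h, hset k s 40 v (by simp) h,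
      hset k s 41 v (by simp) h⟩
  suffices (fun k s => s.reg d = b ∧ I (min k b) s) 0 ((forBelow d i P).run s) by
    simpa using this.2
  rw [forBelow, run]
  -- The minimum keeps the invariant at `I b` during the skipped indices.
  refine iter_induction (fun k s => s.reg d = b ∧ I (min k b) s) ⟨by simp [h1, hd], ?_⟩ ?_
  · rw [min_eq_right hb]
    exact (hset' _ _ _ h).1
  · rintro k s' - ⟨hd', hI⟩
    have e : (guard d i P).run (s'.setReg i k) =
        if b - k = 0 then ((s'.setReg i k).setReg 40 (b - k)).setReg 41 0
        else P.run ((s'.setReg i k).setReg 40 (b - k)) := by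
      simp [guard, run, skip, h1, hd']
    rw [e]
    have hI' := (hset' _ _ (b - k) (hset' _ _ k hI).1).2.1
    by_cases hk : k < b
    · have hne : b - k ≠ 0 := by omega
      rw [if_neg hne]
      rw [min_eq_left (by omega)] at hI' ⊢
      refine ⟨?_, step k _ hk hI' ?_⟩
      · rw [run_reg h4]
        simp [h1, h2, hd']
      · simp [hi.1]
    · have hne : b - k = 0 := by omega
      rw [min_eq_right (by omega)] at hI' ⊢
      rw [if_pos hne]
      exact ⟨by simp [h1, h2, h3, hd'], (hset' _ _ 0 hI').2.2⟩

/-- A loop establishes for all indices what its body establishes for one, if this persists. -/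
theorem forBelow_forall {d i : ℕ} {P : BProg} (Inv : State → Prop) (G : ℕ → State → Prop)
    {b : ℕ} {s : State}
    (hb : b ≤ s.reg 0) (hd : s.reg d = b) (hdi : d ∉ i :: 40 :: 41 :: P.regs)
    (hi : i ∉ [40, 41])
    (hset : ∀ s r v, r ∈ [i, 40, 41] → Inv s → Inv (s.setReg r v))
    (hsetG : ∀ k s r v, r ∈ [i, 40, 41] → G k s → G k (s.setReg r v))
    (h : Inv s) (step : ∀ k s, k < b → Inv s → s.reg i = k → Inv (P.run s) ∧ G k (P.run s))
    (hG : ∀ k s, Inv s → G k s → G k (P.run s)) :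
    Inv ((forBelow d i P).run s) ∧ ∀ k < b, G k ((forBelow d i P).run s) := by
  have := forBelow_induction (fun k s => Inv s ∧ ∀ k' < b, k ≤ k' → G k' s) hb hd hdi hi
    (fun k s r v hr h => ⟨hset s r v hr h.1, fun k' hk' hkk => hsetG k' s r v hr (h.2 k' hk' hkk)⟩)
    ⟨h, fun k' h1 h2 => absurd h1 (by omega)⟩ (fun k s hk hI hik => by
      obtain ⟨h1, h2⟩ := step k s hk hI.1 hik
      refine ⟨h1, fun k' hk' hkk => ?_⟩
      rcases eq_or_lt_of_le hkk with rfl | hlt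
      · exact h2
      · exact hG k' s hI.1 (hI.2 k' hk' hlt))
  exact ⟨this.1, fun k hk => this.2 k hk (Nat.zero_le k)⟩

end BProg

end GraphSim
namespace GraphSim

/-! ### Reading the input -/

/-- The array `f` holds the word `l` from the place `i` on. -/
def Holds (f : ℕ → ℕ) (i : ℕ) (l : List Bool) : Prop :=
  ∀ (k : ℕ) (h : k < l.length), f (i + k) = (l[k]).toNat

theorem holds_append {f : ℕ → ℕ} {i : ℕ} {l l' : List Bool} :
    Holds f i (l ++ l') ↔ Holds f i l ∧ Holds f (i + l.length) l' := by
  constructor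
  · intro h
    refine ⟨fun k hk => ?_, fun k hk => ?_⟩
    · have := h k (by simp; omega)
      rwa [List.getElem_append_left hk] at this
    · have := h (l.length + k) (by simp; omega)
      rw [List.getElem_append_right (by omega)] at this
      simpa [Nat.add_assoc] using this
  · rintro ⟨h, h'⟩ k hk
    by_cases hl : k < l.length
    · rw [List.getElem_append_left hl, h k hl]
    · rw [List.getElem_append_right (by omega), ← h' (k - l.length) (by simp at hk; omega)]
      congr 1
      omega

theorem Holds.unary {f : ℕ → ℕ} {i k : ℕ} (h : Holds f i (unary k)) :
    (∀ j < k, f (i + j) = 1) ∧ f (i + k) = 0 := by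
  rw [GraphSim.unary, holds_append] at h
  refine ⟨fun j hj => ?_, ?_⟩
  · have := h.1 j (by simpa using hj)
    simpa using this
  · have := h.2 0 (by simp)
    simpa using this

theorem bitMatrix_eq_ofFn {a b : ℕ} (A : Fin a → Fin b → Prop) [∀ i j, Decidable (A i j)] :
    bitMatrix A = List.ofFn fun k : Fin (a * b) =>
      decide (A (finProdFinEquiv.symm k).1 (finProdFinEquiv.symm k).2) := by
  rw [List.ofFn_mul, bitMatrix, List.flatMap, List.ofFn_eq_map]
  congr 1
  refine List.map_congr_left fun i _ => ?_
  rw [List.ofFn_eq_map]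
  refine List.map_congr_left fun j _ => ?_
  have : (⟨i * b + j, by
      have := i.2; have := j.2
      calc (i : ℕ) * b + j < i * b + b := by omega
        _ = (i + 1) * b := by ring
        _ ≤ a * b := Nat.mul_le_mul_right _ (by omega)⟩ : Fin (a * b)) =
      finProdFinEquiv (i, j) := by
    ext
    simp [finProdFinEquiv]
    ring
  rw [this, Equiv.symm_apply_apply]
  simp

theorem bitMatrix_length {a b : ℕ} (A : Fin a → Fin b → Prop) :
    (bitMatrix A).length = a * b := by
  classical
  simp [bitMatrix_eq_ofFn]

theorem mul_add_lt {a b : ℕ} (i : Fin a) (j : Fin b) : (i : ℕ) * b + j < a * b := by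
  have := (finProdFinEquiv (i, j)).2
  simp only [finProdFinEquiv, Equiv.coe_fn_mk] at this
  rwa [Nat.mul_comm, Nat.add_comm]

theorem mul_add_inj {a b : ℕ} {i i' : Fin a} {j j' : Fin b}
    (h : (i : ℕ) * b + j = i' * b + j') : i = i' ∧ j = j' := by
  have : finProdFinEquiv (i, j) = finProdFinEquiv (i', j') := by
    ext
    simp only [finProdFinEquiv, Equiv.coe_fn_mk]
    linarith [Nat.mul_comm b i, Nat.mul_comm b i']
  simpa using this

theorem bitMatrix_getElem {a b : ℕ} (A : Fin a → Fin b → Prop) [∀ i j, Decidable (A i j)]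
    (i : Fin a) (j : Fin b) (h : (i : ℕ) * b + j < (bitMatrix A).length) :
    (bitMatrix A)[(i : ℕ) * b + j] = decide (A i j) := by
  simp only [bitMatrix_eq_ofFn, List.getElem_ofFn]
  have : (⟨i * b + j, mul_add_lt i j⟩ : Fin (a * b)) = finProdFinEquiv (i, j) := by
    ext
    simp [finProdFinEquiv]
    ring
  rw [this, Equiv.symm_apply_apply]

/-- The address has the form in which programs compute it: a tabulated multiple, then the start of
the matrix, then the column. -/
theorem Holds.bitMatrix {f : ℕ → ℕ} {i a b : ℕ} {A : Fin a → Fin b → Prop}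
    (h : Holds f i (bitMatrix A)) (u : Fin a) (v : Fin b) :
    f (u * b + i + v) ≠ 0 ↔ A u v := by
  classical
  have := h (u * b + v) (by rw [bitMatrix_length]; exact mul_add_lt u v)
  rw [bitMatrix_getElem] at this
  rw [show (u : ℕ) * b + i + v = i + (u * b + v) by ring, this]
  by_cases hA : A u v <;> simp [hA]

theorem holds_init (w : List Bool) : Holds ((State.init w).arr 0) 0 w := by
  intro k hk
  simp [State.init, hk]

namespace BProg

/-- Read a number in unary at the place `reg 11`. -/
def scan (d : ℕ) : BProg :=
  add 12 11 1 ;; rep 20 (load 0 40 11 ;; ite 40 (add 11 11 2) skip) ;; sub d 11 12 ;; add 11 11 2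

/-- The loop has a fixed length and may outlast the number, but the pointer moves only over ones and
so comes to rest on the terminating zero: after `t` rounds it has advanced by `min t k`. The last
instruction steps over that zero. -/
theorem scan_run {d k i : ℕ} {s : State} (h1 : s.reg 1 = 0) (h2 : s.reg 2 = 1)
    (h11 : s.reg 11 = i) (hk : k ≤ s.reg 0) (hs : Holds (s.arr 0) i (unary k))
    (hd : d ∉ [2, 11]) :
    ((scan d).run s).reg d = k ∧ ((scan d).run s).reg 11 = i + (unary k).length := by
  have hu : (unary k).length = k + 1 := by simp [unary]
  have key := iter_induction (f := (load 0 40 11 ;; ite 40 (add 11 11 2) skip).run) (i := 20)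
    (fun j s' => s'.reg 2 = 1 ∧ s'.arr 0 = s.arr 0 ∧ s'.reg 12 = i ∧
      s'.reg 11 = i + min (s.reg 0 - j) k)
    (k := s.reg 0) (s := (s.setReg 12 i).setReg 20 (s.reg 0))
    (by simp [h2, h11]) (by
      rintro j s' hj ⟨e2, e0, e12, e11⟩
      obtain ⟨hone, hzero⟩ := hs.unary
      by_cases hlt : s.reg 0 - (j + 1) < k
      · have := hone _ hlt
        rw [min_eq_left hlt.le] at e11
        simp [run, e2, e0, e12, e11, this]
        omega
      · rw [min_eq_right (by omega)] at e11
        simp [run, skip, e2, e0, e12, e11, hzero]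
        omega)
  simp only [List.mem_cons, List.not_mem_nil, not_or, not_false_eq_true, and_true] at hd
  have hrun : (add 12 11 1).run s = s.setReg 12 i := by simp [run, h1, h11]
  have hX : (rep 20 (load 0 40 11 ;; ite 40 (add 11 11 2) skip)).run ((add 12 11 1).run s) =
      iter (load 0 40 11 ;; ite 40 (add 11 11 2) skip).run 20 (s.reg 0)
        ((s.setReg 12 i).setReg 20 (s.reg 0)) := by
    rw [hrun]
    rfl
  have hS : (scan d).run s = (sub d 11 12 ;; add 11 11 2).run
      ((rep 20 (load 0 40 11 ;; ite 40 (add 11 11 2) skip)).run ((add 12 11 1).run s)) := rfl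
  rw [hS, hX]
  generalize iter _ _ _ _ = X at key
  obtain ⟨e2, -, e12, e11⟩ := key
  rw [Nat.sub_zero, min_eq_right hk] at e11
  rw [hu]
  simp [run, e2, e12, e11, hd.2, Ne.symm hd.1, Ne.symm hd.2, Nat.add_assoc]

/-- Tabulate the multiples of `reg 3` and of `reg 4`. -/
def tables : BProg :=
  const 13 0 ;; const 14 0 ;; const 15 0 ;;
    rep 20 (store 3 13 14 ;; store 4 13 15 ;; add 13 13 2 ;; add 14 14 3 ;; add 15 15 4)

/-- The machine cannot multiply, so multiples are produced by repeated addition; registers `14` and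
`15` hold the next entries. -/
theorem tables_run {s : State} (h2 : s.reg 2 = 1) (k : ℕ) (hk : k < s.reg 0) :
    (tables.run s).arr 3 k = k * s.reg 3 ∧ (tables.run s).arr 4 k = k * s.reg 4 := by
  have key := iter_induction
    (f := (store 3 13 14 ;; store 4 13 15 ;; add 13 13 2 ;; add 14 14 3 ;; add 15 15 4).run)
    (i := 20)
    (fun j s' => s'.reg 2 = 1 ∧ s'.reg 3 = s.reg 3 ∧ s'.reg 4 = s.reg 4 ∧
      s'.reg 13 = s.reg 0 - j ∧ s'.reg 14 = (s.reg 0 - j) * s.reg 3 ∧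
      s'.reg 15 = (s.reg 0 - j) * s.reg 4 ∧
      ∀ k < s.reg 0 - j, s'.arr 3 k = k * s.reg 3 ∧ s'.arr 4 k = k * s.reg 4)
    (k := s.reg 0)
    (s := (((s.setReg 13 0).setReg 14 0).setReg 15 0).setReg 20 (s.reg 0))
    (by simp [h2]) (by
      rintro j s' hj ⟨e2, e3, e4, e13, e14, e15, hk⟩
      have hs : s.reg 0 - j = s.reg 0 - (j + 1) + 1 := by omega
      rw [hs]
      generalize s.reg 0 - (j + 1) = t at *
      refine ⟨by simp [run, e2], by simp [run, e3], by simp [run, e4], by simp [run, e13, e2],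
        by simp [run, e14, e3, Nat.succ_mul], by simp [run, e15, e4, Nat.succ_mul],
        fun k hkt => ?_⟩
      simp only [run, State.setReg_arr, State.setArr_arr, State.setReg_reg, State.setArr_reg,
        e13, e14, e15]
      by_cases hkt' : k = t
      · simp [hkt']
      · simp [hkt', hk k (by omega)])
  have := key.2.2.2.2.2.2 k (by omega)
  simpa [tables, run] using this

/-- Compute the places of the matrices in the input. -/
def bases : BProg :=
  load 3 40 3 ;; add 8 7 40 ;; load 3 40 5 ;; add 9 8 40 ;; load 3 40 6 ;; add 9 9 40 ;;
    load 3 40 4 ;; add 10 9 40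

/-- Read the input. -/
def setup : BProg :=
  (scan 3 ;; scan 4 ;; scan 5 ;; scan 6) ;; add 7 11 1 ;; tables ;; bases

end BProg

variable {p q n : ℕ}

/-- The registers and arrays describe the marked graph `M` and the input colors `a`. -/
structure Env (M : MarkedGraph p q n) (a : Fin p → Fin n) (s : State) : Prop where
  zero : s.reg 1 = 0
  one : s.reg 2 = 1
  ν_eq : s.reg 3 = M.ν
  n_eq : s.reg 4 = n
  p_eq : s.reg 5 = p
  ν_lt : M.ν < s.reg 0
  n_lt : n < s.reg 0
  p_lt : p < s.reg 0
  prod_le : M.ν * n ≤ s.reg 0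
  mulν : ∀ k < s.reg 0, s.arr 3 k = k * M.ν
  muln : ∀ k < s.reg 0, s.arr 4 k = k * n
  adj : ∀ u v : Fin M.ν, s.arr 0 (u * M.ν + s.reg 7 + v) ≠ 0 ↔ M.graph.Adj u v
  x : ∀ (j : Fin p) (v : Fin M.ν), s.arr 0 (j * M.ν + s.reg 8 + v) ≠ 0 ↔ M.x j = v
  r : ∀ (i : Fin n) (v : Fin M.ν), s.arr 0 (i * M.ν + s.reg 9 + v) ≠ 0 ↔ M.r i = v
  a : ∀ (j : Fin p) (c : Fin n), s.arr 0 (j * n + s.reg 10 + c) ≠ 0 ↔ a j = c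

theorem env_setup (M : MarkedGraph p q n) (a : Fin p → Fin n) {s : State}
    (h0 : s.reg 0 = (M.code a).length) (h1 : s.reg 1 = 0) (h2 : s.reg 2 = 1)
    (h11 : s.reg 11 = 0) (hs : Holds (s.arr 0) 0 (M.code a)) :
    Env M a (BProg.setup.run s) := by
  -- The length of the code dominates every loop bound. The four terminating zeros make the bounds
  -- for `ν`, `n`, `p`, `q` strict, and the matrix of reference vertices accounts for `ν * n`.
  have hlen : M.ν + n + p + q + 4 + M.ν * M.ν + n * M.ν ≤ s.reg 0 := by
    rw [h0]
    simp [MarkedGraph.code, unary, bitMatrix_length]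
    omega
  simp only [MarkedGraph.code, holds_append] at hs
  obtain ⟨⟨⟨⟨⟨⟨⟨⟨hν, hn⟩, hp⟩, hq⟩, hadj⟩, hx⟩, hy⟩, hr⟩, ha⟩ := hs
  simp only [List.length_append, bitMatrix_length, ← Nat.add_assoc] at hn hp hq hadj hx hy hr ha
  set iν := (unary M.ν).length
  set inn := (unary n).length
  set ip := (unary p).length
  set iq := (unary q).length
  simp only [Nat.zero_add] at hn hp hq hadj hx hy hr ha
  obtain ⟨d1, e1⟩ := BProg.scan_run (d := 3) (k := M.ν) h1 h2 h11 (by omega) hν (by decide)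
  set s1 := (BProg.scan 3).run s with hs1
  have f1 : ∀ r ∉ (BProg.scan 3).regs, s1.reg r = s.reg r := fun r hr => BProg.run_reg hr s
  have a1 : s1.arr 0 = s.arr 0 := BProg.run_arr (by decide) s
  rw [← a1] at hn
  obtain ⟨d2, e2⟩ := BProg.scan_run (d := 4) (k := n) (s := s1) ((f1 1 (by decide)).trans h1)
    ((f1 2 (by decide)).trans h2) e1 (by rw [f1 0 (by decide)]; omega)
    (by simpa using hn) (by decide)
  set s2 := (BProg.scan 4).run s1 with hs2
  have f2 : ∀ r ∉ (BProg.scan 4).regs, s2.reg r = s1.reg r := fun r hr => BProg.run_reg hr s1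
  have a2 : s2.arr 0 = s.arr 0 := (BProg.run_arr (by decide) s1).trans a1
  rw [← a2] at hp
  obtain ⟨d3, e3⟩ := BProg.scan_run (d := 5) (k := p) (s := s2)
    ((f2 1 (by decide)).trans ((f1 1 (by decide)).trans h1))
    ((f2 2 (by decide)).trans ((f1 2 (by decide)).trans h2)) e2
    (by rw [f2 0 (by decide), f1 0 (by decide)]; omega) (by simpa using hp) (by decide)
  set s3 := (BProg.scan 5).run s2 with hs3
  have f3 : ∀ r ∉ (BProg.scan 5).regs, s3.reg r = s2.reg r := fun r hr => BProg.run_reg hr s2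
  have a3 : s3.arr 0 = s.arr 0 := (BProg.run_arr (by decide) s2).trans a2
  rw [← a3] at hq
  have z3 : s3.reg 0 = s.reg 0 := by
    rw [f3 0 (by decide), f2 0 (by decide), f1 0 (by decide)]
  have o3 : s3.reg 1 = 0 := by rw [f3 1 (by decide), f2 1 (by decide), f1 1 (by decide), h1]
  have t3 : s3.reg 2 = 1 := by rw [f3 2 (by decide), f2 2 (by decide), f1 2 (by decide), h2]
  obtain ⟨d4, e4⟩ := BProg.scan_run (d := 6) (k := q) (s := s3) o3 t3 e3 (by rw [z3]; omega)
    (by simpa using hq) (by decide)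
  set s4 := (BProg.scan 6).run s3 with hs4
  have f4 : ∀ r ∉ (BProg.scan 6).regs, s4.reg r = s3.reg r := fun r hr => BProg.run_reg hr s3
  have a4 : s4.arr 0 = s.arr 0 := (BProg.run_arr (by decide) s3).trans a3
  have hrun : BProg.setup.run s =
      BProg.bases.run (BProg.tables.run ((BProg.add 7 11 1).run s4)) := rfl
  have r1 : s4.reg 1 = 0 := (f4 1 (by decide)).trans o3
  have r2 : s4.reg 2 = 1 := (f4 2 (by decide)).trans t3
  have r0 : s4.reg 0 = s.reg 0 := (f4 0 (by decide)).trans z3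
  have r3 : s4.reg 3 = M.ν := by
    rw [f4 3 (by decide), f3 3 (by decide), f2 3 (by decide), d1]
  have r4 : s4.reg 4 = n := by rw [f4 4 (by decide), f3 4 (by decide), d2]
  have r5 : s4.reg 5 = p := by rw [f4 5 (by decide), d3]
  have h5 : (BProg.add 7 11 1).run s4 = s4.setReg 7 (iν + inn + ip + iq) := by
    simp [BProg.run, r1, e4]
    rfl
  rw [h5] at hrun
  have ht := BProg.tables_run (s := s4.setReg 7 (iν + inn + ip + iq)) (by simpa using r2)
  set s6 := BProg.tables.run (s4.setReg 7 (iν + inn + ip + iq)) with hs6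
  have f6 : ∀ r ∉ 7 :: BProg.tables.regs, s6.reg r = s4.reg r := fun r hr => by
    simp only [List.mem_cons, not_or] at hr
    rw [hs6, BProg.run_reg hr.2]
    simp [hr.1]
  have r67 : s6.reg 7 = iν + inn + ip + iq := by
    rw [hs6, BProg.run_reg (by decide)]
    simp
  have a6 : s6.arr 0 = s.arr 0 := (BProg.run_arr (by decide) _).trans a4
  simp [r3, r4, r0] at ht
  have r60 := (f6 0 (by decide)).trans r0
  have r63 := (f6 3 (by decide)).trans r3
  have r64 := (f6 4 (by decide)).trans r4
  have r65 := (f6 5 (by decide)).trans r5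
  have r66 := (f6 6 (by decide)).trans d4
  have t3 := (ht M.ν (by omega)).1
  have t4 := (ht n (by omega)).1
  have t5 := (ht p (by omega)).1
  have t6 := (ht q (by omega)).1
  have f7 : ∀ r ∉ BProg.bases.regs, (BProg.bases.run s6).reg r = s6.reg r :=
    fun r hr => BProg.run_reg hr s6
  have a7 : (BProg.bases.run s6).arr = s6.arr := rfl
  have b8 : (BProg.bases.run s6).reg 8 = iν + inn + ip + iq + M.ν * M.ν := by
    simp [BProg.bases, BProg.run, r63, t3, r67]
  have b9 : (BProg.bases.run s6).reg 9 =
      iν + inn + ip + iq + M.ν * M.ν + p * M.ν + q * M.ν := by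
    simp [BProg.bases, BProg.run, r63, r65, r66, t3, t5, t6, r67]
  have b10 : (BProg.bases.run s6).reg 10 =
      iν + inn + ip + iq + M.ν * M.ν + p * M.ν + q * M.ν + n * M.ν := by
    simp [BProg.bases, BProg.run, r63, r64, r65, r66, t3, t4, t5, t6, r67]
  have g0 : (BProg.bases.run s6).reg 0 = s.reg 0 := (f7 0 (by decide)).trans r60
  rw [hrun]
  constructor
  · rw [f7 1 (by decide), f6 1 (by decide), r1]
  · rw [f7 2 (by decide), f6 2 (by decide), r2]
  · rw [f7 3 (by decide), r63]
  · rw [f7 4 (by decide), r64]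
  · rw [f7 5 (by decide), r65]
  · rw [g0]; omega
  · rw [g0]; omega
  · rw [g0]; omega
  · rw [g0, Nat.mul_comm]; omega
  · rw [g0, a7]; exact fun k hk => (ht k hk).1
  · rw [g0, a7]; exact fun k hk => (ht k hk).2
  · rw [a7, a6, f7 7 (by decide), r67]; exact hadj.bitMatrix
  · rw [a7, a6, b8]; exact hx.bitMatrix
  · rw [a7, a6, b9]; exact hr.bitMatrix
  · rw [a7, a6, b10]; exact ha.bitMatrix

end GraphSim
namespace GraphSim

variable {p q n : ℕ}

/-! ### The forcing algorithm -/

/-- Direct forcing eliminates the color `c` from the list of `z`. -/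
def Dead (M : MarkedGraph p q n) (a : Fin p → Fin n) (z : Fin M.ν) (c : Fin n) : Prop :=
  ∀ L : Fin M.ν → Finset (Fin n), Stable M.graph L → L ≤ M.initialLists a → c ∉ L z

/-- The soundness of one propagation: in every stable family the list of `u` lies in `{c}`. -/
theorem Dead.of_adj {M : MarkedGraph p q n} {a : Fin p → Fin n} {u v : Fin M.ν} {c : Fin n}
    (huv : M.graph.Adj u v) (h : ∀ c', c' ≠ c → Dead M a u c') : Dead M a v c := by
  intro L hL hle
  refine hL u v c huv fun c' hc' => ?_
  by_contra hne
  exact h c' (by simpa using hne) L hL hle hc'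

theorem Dead.of_initial {M : MarkedGraph p q n} {a : Fin p → Fin n} {z : Fin M.ν} {c : Fin n}
    (h : c ∉ M.initialLists a z) : Dead M a z c :=
  fun _ _ hle hc => h (hle z hc)

/-- The array `2` marks the color `c` at the vertex `z`. -/
def Marked {ν n : ℕ} (s : State) (z : Fin ν) (c : Fin n) : Prop := s.arr 2 (z * n + c) ≠ 0

/-- The state describes `M` and `a`, the marked colors are dead, and those in `E` are marked. -/
structure Good (M : MarkedGraph p q n) (a : Fin p → Fin n) (E : Fin M.ν → Fin n → Prop)
    (s : State) : Prop where
  env : Env M a s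
  sound : ∀ z c, Marked s z c → Dead M a z c
  marked : ∀ z c, E z c → Marked s z c

variable {M : MarkedGraph p q n} {a : Fin p → Fin n} {E : Fin M.ν → Fin n → Prop}

theorem Env.congr {s s' : State} (h : Env M a s) (hr : ∀ r < 11, s'.reg r = s.reg r)
    (h0 : s'.arr 0 = s.arr 0) (h3 : s'.arr 3 = s.arr 3) (h4 : s'.arr 4 = s.arr 4) :
    Env M a s' := by
  constructor <;>
    simp only [h0, h3, h4, hr 0 (by decide), hr 1 (by decide), hr 2 (by decide), hr 3 (by decide),
      hr 4 (by decide), hr 5 (by decide), hr 7 (by decide), hr 8 (by decide), hr 9 (by decide),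
      hr 10 (by decide)]
  exacts [h.zero, h.one, h.ν_eq, h.n_eq, h.p_eq, h.ν_lt, h.n_lt, h.p_lt, h.prod_le, h.mulν,
    h.muln, h.adj, h.x, h.r, h.a]

theorem Good.congr {s s' : State} (h : Good M a E s) (hr : ∀ r < 11, s'.reg r = s.reg r)
    (ha : s'.arr = s.arr) : Good M a E s' where
  env := h.env.congr hr (by rw [ha]) (by rw [ha]) (by rw [ha])
  sound := by unfold Marked; rw [ha]; exact h.sound
  marked := by unfold Marked; rw [ha]; exact h.marked

theorem Good.setReg {s : State} (h : Good M a E s) {r v : ℕ} (hr : 11 ≤ r) :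
    Good M a E (s.setReg r v) :=
  h.congr (fun r' hr' => by simp; omega) rfl

namespace BProg

theorem marked_run {P : BProg} (h2 : 2 ∉ P.regs) (h : P.onlySets = true) {s : State}
    (hs : s.reg 2 = 1) {ν n : ℕ} {z : Fin ν} {c : Fin n} (hm : Marked s z c) :
    Marked (P.run s) z c :=
  run_arr_two_ne_zero h2 h hs hm

/-- The syntactic conditions for the use of a loop. -/
def LoopOk (d i : ℕ) (P : BProg) : Bool :=
  !((i :: 40 :: 41 :: P.regs).contains d) && 11 ≤ i && i < 40 && !(P.regs.contains 2) && P.onlySets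

/-- The loop rule for all marking programs. Iteration `k` makes the marks in `G k`, and as marks
persist, all of them are present at the end. Registers that the loop does not write keep their
values, which hands the outer indices to nested loops. -/
theorem good_forBelow {d i : ℕ} {P : BProg} (G : ℕ → Fin M.ν → Fin n → Prop) {b : ℕ} {s : State}
    (hs : Good M a E s) (hd : s.reg d = b) (hb : b < s.reg 0) (hok : LoopOk d i P = true)
    (step : ∀ s' k, k < b → Good M a E s' →
      (∀ r ∉ i :: 40 :: 41 :: P.regs, s'.reg r = s.reg r) → s'.reg i = k →
      Good M a E (P.run s') ∧ ∀ z c, G k z c → Marked (P.run s') z c) :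
    Good M a E ((forBelow d i P).run s) ∧
      ∀ k < b, ∀ z c, G k z c → Marked ((forBelow d i P).run s) z c := by
  simp only [LoopOk, Bool.and_eq_true, Bool.not_eq_true', List.contains_eq_mem,
    decide_eq_false_iff_not, decide_eq_true_eq] at hok
  obtain ⟨⟨⟨⟨h1, h2⟩, h3⟩, h4⟩, h5⟩ := hok
  have hr : ∀ r, r ∈ [i, 40, 41] → 11 ≤ r := by
    intro r hr
    simp only [List.mem_cons, List.not_mem_nil, or_false] at hr
    omega
  have := forBelow_forall
    (fun s' => Good M a E s' ∧ ∀ r ∉ i :: 40 :: 41 :: P.regs, s'.reg r = s.reg r)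
    (fun k s' => ∀ z c, G k z c → Marked s' z c) hb.le hd h1 (by simp; omega)
    (fun s' r v hr' h => ⟨h.1.setReg (hr r hr'), fun r' hr'' => by
      have : r' ≠ r := by
        rintro rfl
        simp only [List.mem_cons, List.not_mem_nil, or_false, not_or] at hr' hr''
        omega
      simp [this, h.2 r' hr'']⟩)
    (fun _ _ _ _ _ h => h) ⟨hs, fun _ _ => rfl⟩
    (fun k s' hk h hi => by
      obtain ⟨e1, e2⟩ := step s' k hk h.1 h.2 hi
      refine ⟨⟨e1, fun r hr => ?_⟩, e2⟩
      have hrP : r ∉ P.regs := fun h => hr (by simp [h])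
      rw [run_reg hrP, h.2 r hr])
    (fun k s' h hG z c hz => marked_run h4 h5 h.1.env.one (hG z c hz))
  exact ⟨this.1.1, this.2⟩

/-- Mark the color `reg c` at the vertex `reg z`. -/
def mark (z c : ℕ) : BProg := load 4 45 z ;; add 45 45 c ;; store 2 45 2

/-- By `mul_add_inj` an address belongs to one pair only, so soundness has to be checked only for
the new mark. -/
theorem good_mark {z c : ℕ} {s : State} (hs : Good M a E s) (hc : c ≠ 45)
    {z' : Fin M.ν} {c' : Fin n} (ez : s.reg z = z') (ec : s.reg c = c') (hd : Dead M a z' c') :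
    Good M a E ((mark z c).run s) ∧ Marked ((mark z c).run s) z' c' := by
  have e : (mark z c).run s =
      ((s.setReg 45 (z' * n)).setReg 45 (z' * n + c')).setArr 2 (z' * n + c') 1 := by
    have := hs.env.muln z' (z'.2.trans hs.env.ν_lt)
    simp [mark, run, ez, ec, hc, this, hs.env.one]
  rw [e]
  refine ⟨⟨hs.env.congr (fun r hr => ?_) ?_ ?_ ?_, fun u d hu => ?_, fun u d hu => ?_⟩, ?_⟩
  · have : r ≠ 45 := by omega
    simp [this]
  · funext i; simp
  · funext i; simp
  · funext i; simp
  · by_cases h : (u : ℕ) * n + d = z' * n + c'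
    · obtain ⟨rfl, rfl⟩ := mul_add_inj h
      exact hd
    · exact hs.sound u d (by simpa [Marked, h] using hu)
  · have := hs.marked u d hu
    by_cases h : (u : ℕ) * n + d = z' * n + c'
    · simp [Marked, h]
    · simpa [Marked, h] using this
  · simp [Marked]

/-- Execute `P` or `Q` according to the entry `(reg i, reg j)` of the input matrix that begins at
the place `reg base`; the array `k` holds the multiples of the length of its rows. -/
def ifBit (base k i j : ℕ) (P Q : BProg) : BProg :=
  load k 45 i ;; add 45 45 base ;; add 45 45 j ;; load 0 46 45 ;; ite 46 P Q

theorem ifBit_run {base k i j : ℕ} (P Q : BProg) (s : State) (hb : base < 40) (hj : j < 40) :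
    ∃ s' : State, s'.arr = s.arr ∧ (∀ r < 40, s'.reg r = s.reg r) ∧
      (ifBit base k i j P Q).run s =
        if s.arr 0 (s.arr k (s.reg i) + s.reg base + s.reg j) = 0 then Q.run s' else P.run s' := by
  have h1 : base ≠ 45 := by omega
  have h2 : j ≠ 45 := by omega
  refine ⟨(load k 45 i ;; add 45 45 base ;; add 45 45 j ;; load 0 46 45).run s, rfl,
    fun r hr => ?_, ?_⟩
  · have h3 : r ≠ 45 := by omega
    have h4 : r ≠ 46 := by omega
    simp [run, h3, h4]
  · simp [ifBit, run, h1, h2]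

theorem skip_good {s : State} (h : Good M a E s) : Good M a E (skip.run s) :=
  h.setReg (by norm_num)

/-! ### Marking the colors outside the initial lists -/

/-- Mark the colors that an input vertex must not have. -/
def initX : BProg :=
  forBelow 5 21 (forBelow 3 22 (ifBit 8 3 21 22
    (forBelow 4 23 (ifBit 10 4 21 23 skip (mark 22 23))) skip))

theorem good_initX {s : State} (hs : Good M a E s) :
    Good M a E (initX.run s) ∧
      ∀ j c, c ≠ a j → Marked (initX.run s) (M.x j) c := by
  have key := good_forBelow (d := 5) (i := 21) (P := forBelow 3 22 (ifBit 8 3 21 22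
      (forBelow 4 23 (ifBit 10 4 21 23 skip (mark 22 23))) skip))
    (fun k z c => ∃ j : Fin p, (j : ℕ) = k ∧ M.x j = z ∧ c ≠ a j) hs hs.env.p_eq hs.env.p_lt
    (by decide) (fun s1 k1 hk1 hs1 hf1 hi1 => ?_)
  · exact ⟨key.1, fun j c hc => key.2 j j.2 _ _ ⟨j, rfl, rfl, hc⟩⟩
  have key := good_forBelow (d := 3) (i := 22) (P := ifBit 8 3 21 22
      (forBelow 4 23 (ifBit 10 4 21 23 skip (mark 22 23))) skip)
    (fun k z c => ∃ j : Fin p, (j : ℕ) = k1 ∧ (z : ℕ) = k ∧ M.x j = z ∧ c ≠ a j) hs1 hs1.env.ν_eq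
    hs1.env.ν_lt (by decide) (fun s2 k2 hk2 hs2 hf2 hi2 => ?_)
  · exact ⟨key.1, fun z c ⟨j, hj, hz, hc⟩ => key.2 z z.2 _ _ ⟨j, hj, rfl, hz, hc⟩⟩
  have h21 : s2.reg 21 = k1 := (hf2 21 (by decide)).trans hi1
  obtain ⟨s3, ha3, hr3, e3⟩ := ifBit_run (base := 8) (k := 3) (i := 21) (j := 22)
    (forBelow 4 23 (ifBit 10 4 21 23 skip (mark 22 23))) skip s2 (by norm_num) (by norm_num)
  have hs3 : Good M a E s3 := hs2.congr (fun r hr => hr3 r (by omega)) ha3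
  rw [h21, hi2, hs2.env.mulν _ (hk1.trans hs2.env.p_lt)] at e3
  have hx := hs2.env.x ⟨k1, hk1⟩ ⟨k2, hk2⟩
  rw [e3]
  split_ifs with hbit
  · refine ⟨skip_good hs3, fun z c ⟨j, hj, hz, hz', hc⟩ => absurd hbit (hx.2 ?_)⟩
    subst hj hz
    exact hz'
  have hx := hx.1 hbit
  have key := good_forBelow (d := 4) (i := 23) (P := ifBit 10 4 21 23 skip (mark 22 23))
    (fun k z c => ∃ j : Fin p, (j : ℕ) = k1 ∧ (z : ℕ) = k2 ∧ (c : ℕ) = k ∧ M.x j = z ∧ c ≠ a j) hs3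
    hs3.env.n_eq hs3.env.n_lt (by decide) (fun s4 k4 hk4 hs4 hf4 hi4 => ?_)
  · exact ⟨key.1, fun z c ⟨j, hj, hz, hz', hc⟩ => key.2 c c.2 _ _ ⟨j, hj, hz, rfl, hz', hc⟩⟩
  have h21 : s4.reg 21 = k1 :=
    (hf4 21 (by decide)).trans ((hr3 21 (by norm_num)).trans h21)
  have h22 : s4.reg 22 = k2 :=
    (hf4 22 (by decide)).trans ((hr3 22 (by norm_num)).trans hi2)
  obtain ⟨s5, ha5, hr5, e5⟩ := ifBit_run (base := 10) (k := 4) (i := 21) (j := 23)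
    skip (mark 22 23) s4 (by norm_num) (by norm_num)
  have hs5 : Good M a E s5 := hs4.congr (fun r hr => hr5 r (by omega)) ha5
  rw [h21, hi4, hs4.env.muln _ (hk1.trans hs4.env.p_lt)] at e5
  have ha := hs4.env.a ⟨k1, hk1⟩ ⟨k4, hk4⟩
  rw [e5]
  split_ifs with hbit'
  · have hne : ⟨k4, hk4⟩ ≠ a ⟨k1, hk1⟩ := fun h => ha.2 h.symm hbit'
    have := good_mark hs5 (z := 22) (c := 23) (by norm_num) (z' := ⟨k2, hk2⟩)
      (c' := ⟨k4, hk4⟩) ((hr5 22 (by norm_num)).trans h22) ((hr5 23 (by norm_num)).trans hi4)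
      (.of_initial fun h => by
        simp only [MarkedGraph.initialLists, Finset.mem_filter] at h
        exact hne (h.2.1 _ hx))
    refine ⟨this.1, fun z c ⟨j, hj, hz, hc, _⟩ => ?_⟩
    subst hz hc
    exact this.2
  · have heq := ha.1 hbit'
    refine ⟨skip_good hs5, fun z c ⟨j, hj, hz, hc, _, hne⟩ => absurd ?_ hne⟩
    subst hj hc
    exact heq.symm

/-- Execute `P` if `reg i ≠ reg j`. -/
def ifNe (i j : ℕ) (P : BProg) : BProg :=
  sub 43 i j ;; sub 44 j i ;; add 43 43 44 ;; ite 43 P skip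

theorem ifNe_run {i j : ℕ} (P : BProg) (s : State) (hi : i < 40) (hj : j < 40) :
    ∃ s' : State, s'.arr = s.arr ∧ (∀ r < 40, s'.reg r = s.reg r) ∧
      (ifNe i j P).run s = if s.reg i = s.reg j then skip.run s' else P.run s' := by
  have h1 : i ≠ 43 := by omega
  have h2 : j ≠ 43 := by omega
  refine ⟨(sub 43 i j ;; sub 44 j i ;; add 43 43 44).run s, rfl, fun r hr => ?_, ?_⟩
  · have h3 : r ≠ 43 := by omega
    have h4 : r ≠ 44 := by omega
    simp [run, h3, h4]
  · have : s.reg i - s.reg j = 0 ∧ s.reg j - s.reg i = 0 ↔ s.reg i = s.reg j := by omega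
    simp [ifNe, run, h1, h2, this]

/-- Mark the colors that a reference vertex must not have. -/
def initR : BProg :=
  forBelow 4 21 (forBelow 3 22 (ifBit 9 3 21 22 (forBelow 4 23 (ifNe 21 23 (mark 22 23))) skip))

theorem good_initR {s : State} (hs : Good M a E s) :
    Good M a E (initR.run s) ∧
      ∀ i c, c ≠ i → Marked (initR.run s) (M.r i) c := by
  have key := good_forBelow (d := 4) (i := 21) (P := forBelow 3 22 (ifBit 9 3 21 22
      (forBelow 4 23 (ifNe 21 23 (mark 22 23))) skip))
    (fun k z c => ∃ i : Fin n, (i : ℕ) = k ∧ M.r i = z ∧ c ≠ i) hs hs.env.n_eq hs.env.n_lt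
    (by decide) (fun s1 k1 hk1 hs1 hf1 hi1 => ?_)
  · exact ⟨key.1, fun j c hc => key.2 j j.2 _ _ ⟨j, rfl, rfl, hc⟩⟩
  have key := good_forBelow (d := 3) (i := 22) (P := ifBit 9 3 21 22
      (forBelow 4 23 (ifNe 21 23 (mark 22 23))) skip)
    (fun k z c => ∃ i : Fin n, (i : ℕ) = k1 ∧ (z : ℕ) = k ∧ M.r i = z ∧ c ≠ i) hs1 hs1.env.ν_eq
    hs1.env.ν_lt (by decide) (fun s2 k2 hk2 hs2 hf2 hi2 => ?_)
  · exact ⟨key.1, fun z c ⟨j, hj, hz, hc⟩ => key.2 z z.2 _ _ ⟨j, hj, rfl, hz, hc⟩⟩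
  have h21 : s2.reg 21 = k1 := (hf2 21 (by decide)).trans hi1
  obtain ⟨s3, ha3, hr3, e3⟩ := ifBit_run (base := 9) (k := 3) (i := 21) (j := 22)
    (forBelow 4 23 (ifNe 21 23 (mark 22 23))) skip s2 (by norm_num) (by norm_num)
  have hs3 : Good M a E s3 := hs2.congr (fun r hr => hr3 r (by omega)) ha3
  rw [h21, hi2, hs2.env.mulν _ (hk1.trans hs2.env.n_lt)] at e3
  have hx := hs2.env.r ⟨k1, hk1⟩ ⟨k2, hk2⟩
  rw [e3]
  split_ifs with hbit
  · refine ⟨skip_good hs3, fun z c ⟨j, hj, hz, hz', hc⟩ => absurd hbit (hx.2 ?_)⟩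
    subst hj hz
    exact hz'
  have hx := hx.1 hbit
  have key := good_forBelow (d := 4) (i := 23) (P := ifNe 21 23 (mark 22 23))
    (fun k z c => ∃ i : Fin n, (i : ℕ) = k1 ∧ (z : ℕ) = k2 ∧ (c : ℕ) = k ∧ M.r i = z ∧ c ≠ i) hs3
    hs3.env.n_eq hs3.env.n_lt (by decide) (fun s4 k4 hk4 hs4 hf4 hi4 => ?_)
  · exact ⟨key.1, fun z c ⟨j, hj, hz, hz', hc⟩ => key.2 c c.2 _ _ ⟨j, hj, hz, rfl, hz', hc⟩⟩
  have h21 : s4.reg 21 = k1 :=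
    (hf4 21 (by decide)).trans ((hr3 21 (by norm_num)).trans h21)
  have h22 : s4.reg 22 = k2 :=
    (hf4 22 (by decide)).trans ((hr3 22 (by norm_num)).trans hi2)
  obtain ⟨s5, ha5, hr5, e5⟩ := ifNe_run (i := 21) (j := 23) (mark 22 23) s4 (by norm_num)
    (by norm_num)
  have hs5 : Good M a E s5 := hs4.congr (fun r hr => hr5 r (by omega)) ha5
  rw [h21, hi4] at e5
  rw [e5]
  split_ifs with hbit'
  · refine ⟨skip_good hs5, fun z c ⟨j, hj, hz, hc, _, hne⟩ => absurd (Fin.ext ?_) hne⟩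
    omega
  · have := good_mark hs5 (z := 22) (c := 23) (by norm_num) (z' := ⟨k2, hk2⟩)
      (c' := ⟨k4, hk4⟩) ((hr5 22 (by norm_num)).trans h22) ((hr5 23 (by norm_num)).trans hi4)
      (.of_initial fun h => by
        simp only [MarkedGraph.initialLists, Finset.mem_filter] at h
        exact hbit' (Fin.val_eq_of_eq (h.2.2 _ hx)).symm)
    refine ⟨this.1, fun z c ⟨j, hj, hz, hc, _⟩ => ?_⟩
    subst hz hc
    exact this.2

/-! ### One round of forcing -/

/-- Set `reg 30` to `0` unless the color `reg 23` is marked at the vertex `reg 21`. -/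
def testMark : BProg := load 4 45 21 ;; add 45 45 23 ;; load 2 46 45 ;; ite 46 skip (const 30 0)

/-- Decide in `reg 30` whether all colors but `reg 22` are marked at the vertex `reg 21`. -/
def check : BProg := const 30 1 ;; forBelow 4 23 (ifNe 22 23 testMark)

/-- The flag is never raised again inside the loop; the invariant says that it is nonzero exactly if
the colors from `k` on, other than `c`, are marked. -/
theorem check_run {s : State} (hs : Env M a s) {u : Fin M.ν} {c : Fin n} (hu : s.reg 21 = u)
    (hc : s.reg 22 = c) :
    (check.run s).reg 30 ≠ 0 ↔ ∀ c', c' ≠ c → Marked s u c' := by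
  have hmul := hs.muln u (u.2.trans hs.ν_lt)
  have key := forBelow_induction (d := 4) (i := 23) (P := ifNe 22 23 testMark)
    (fun k s' => s'.arr = s.arr ∧ s'.reg 21 = u ∧ s'.reg 22 = c ∧
      (s'.reg 30 ≠ 0 ↔ ∀ c' : Fin n, k ≤ c' → c' ≠ c → Marked s u c')) (b := n)
    (s := (const 30 1).run s) (by simpa [run] using hs.n_lt.le) (by simpa [run] using hs.n_eq)
    (by decide) (by decide) ?_ ?_ ?_
  · simpa [check, run] using key.2.2.2
  · intro k s' r v hr ⟨h1, h2, h3, h4⟩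
    simp only [List.mem_cons, List.not_mem_nil, or_false] at hr
    have e21 : 21 ≠ r := by omega
    have e22 : 22 ≠ r := by omega
    have e30 : 30 ≠ r := by omega
    simp only [State.setReg_arr, State.setReg_reg, e21, e22, e30, if_false]
    exact ⟨h1, h2, h3, h4⟩
  · refine ⟨rfl, by simpa [run] using hu, by simpa [run] using hc, ?_⟩
    simp only [run, State.setReg_reg, if_true]
    refine ⟨fun _ c' hc' => absurd c'.2 (by omega), fun _ => one_ne_zero⟩
  · intro k s' hk ⟨h1, h2, h3, h4⟩ hik
    have hsplit : ∀ Q : Fin n → Prop, (∀ c' : Fin n, k ≤ c' → Q c') ↔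
        Q ⟨k, hk⟩ ∧ ∀ c' : Fin n, k + 1 ≤ c' → Q c' := fun Q =>
      ⟨fun h => ⟨h _ le_rfl, fun c' hc' => h c' (by omega)⟩, fun h c' hc' => by
        rcases eq_or_lt_of_le hc' with he | hlt
        · have : c' = ⟨k, hk⟩ := Fin.ext he.symm
          exact this ▸ h.1
        · exact h.2 c' hlt⟩
    rw [hsplit]
    obtain ⟨s2, ha2, hr2, e2⟩ := ifNe_run (i := 22) (j := 23) testMark s' (by norm_num)
      (by norm_num)
    rw [h3, hik] at e2
    rw [e2]
    split_ifs with hck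
    · have : (⟨k, hk⟩ : Fin n) = c := Fin.ext hck.symm
      simp only [this, ne_eq, not_true_eq_false, false_implies, true_and]
      simp only [skip, run, State.setReg_arr, State.setReg_reg]
      simp [ha2, h1, hr2, h2, h3]
      simpa using h4
    · have hne : (⟨k, hk⟩ : Fin n) ≠ c := fun h => hck (Fin.val_eq_of_eq h).symm
      simp only [hne, ne_eq, not_false_eq_true, true_implies]
      have e21 : s2.reg 21 = u := (hr2 21 (by norm_num)).trans h2
      have e22 : s2.reg 22 = c := (hr2 22 (by norm_num)).trans h3
      have e23 : s2.reg 23 = k := (hr2 23 (by norm_num)).trans hik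
      have e30 : s2.reg 30 = s'.reg 30 := hr2 30 (by norm_num)
      have ha : s2.arr = s.arr := ha2.trans h1
      by_cases hm : s.arr 2 (u * n + k) = 0
      · have hm' : ¬ Marked s u ⟨k, hk⟩ := by simp [Marked, hm]
        simp [testMark, run, skip, e21, e22, e23, ha, hmul, hm, hm']
      · have hm' : Marked s u ⟨k, hk⟩ := by simp [Marked, hm]
        simp [testMark, run, skip, e21, e22, e23, e30, ha, hmul, hm, hm']
        simpa using h4

/-- Mark the color `reg 22` at the neighbors of the vertex `reg 21`. -/
def push : BProg := forBelow 3 24 (ifBit 7 3 21 24 (mark 24 22) skip)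

theorem good_push {s : State} (hs : Good M a E s) {u : Fin M.ν} {c : Fin n} (hu : s.reg 21 = u)
    (hc : s.reg 22 = c) (hd : ∀ c', c' ≠ c → Dead M a u c') :
    Good M a E (push.run s) ∧ ∀ v, M.graph.Adj u v → Marked (push.run s) v c := by
  have key := good_forBelow (d := 3) (i := 24) (P := ifBit 7 3 21 24 (mark 24 22) skip)
    (fun k z c' => (z : ℕ) = k ∧ c' = c ∧ M.graph.Adj u z) hs hs.env.ν_eq hs.env.ν_lt
    (by decide) (fun s1 k1 hk1 hs1 hf1 hi1 => ?_)
  · exact ⟨key.1, fun v hv => key.2 v v.2 _ _ ⟨rfl, rfl, hv⟩⟩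
  have h21 : s1.reg 21 = u := (hf1 21 (by decide)).trans hu
  have h22 : s1.reg 22 = c := (hf1 22 (by decide)).trans hc
  obtain ⟨s3, ha3, hr3, e3⟩ := ifBit_run (base := 7) (k := 3) (i := 21) (j := 24)
    (mark 24 22) skip s1 (by norm_num) (by norm_num)
  have hs3 : Good M a E s3 := hs1.congr (fun r hr => hr3 r (by omega)) ha3
  rw [h21, hi1, hs1.env.mulν _ (u.2.trans hs1.env.ν_lt)] at e3
  have hadj := hs1.env.adj u ⟨k1, hk1⟩
  rw [e3]
  split_ifs with hbit
  · refine ⟨skip_good hs3, fun z c ⟨hz, _, h⟩ => absurd hbit (hadj.2 ?_)⟩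
    subst hz
    exact h
  · have := good_mark hs3 (z := 24) (c := 22) (by norm_num) (z' := ⟨k1, hk1⟩)
      (c' := c) ((hr3 24 (by norm_num)).trans hi1) ((hr3 22 (by norm_num)).trans h22)
      (.of_adj (hadj.1 hbit) hd)
    refine ⟨this.1, fun z c' ⟨hz, hc', _⟩ => ?_⟩
    subst hz hc'
    exact this.2

/-- Apply direct forcing once on every edge and for every color. -/
def round : BProg := forBelow 3 21 (forBelow 4 22 (check ;; ite 30 push skip))

/-- `E` stands for marks known at the start of the round. Marks made during the round may let
further tests succeed, which is harmless: tests rely on marked, hence dead, colors, and what they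
push is dead again. -/
theorem good_round {s : State} (hs : Good M a E s) :
    Good M a E (round.run s) ∧ ∀ u v c, M.graph.Adj u v → (∀ c', c' ≠ c → E u c') →
      Marked (round.run s) v c := by
  have key := good_forBelow (d := 3) (i := 21)
    (P := forBelow 4 22 (check ;; ite 30 push skip))
    (fun k z c => ∃ u : Fin M.ν, (u : ℕ) = k ∧ M.graph.Adj u z ∧ ∀ c', c' ≠ c → E u c')
    hs hs.env.ν_eq hs.env.ν_lt (by decide) (fun s1 k1 hk1 hs1 hf1 hi1 => ?_)
  · exact ⟨key.1, fun u v c huv hc => key.2 u u.2 _ _ ⟨u, rfl, huv, hc⟩⟩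
  have key := good_forBelow (d := 4) (i := 22) (P := check ;; ite 30 push skip)
    (fun k z c => ∃ u : Fin M.ν, (u : ℕ) = k1 ∧ (c : ℕ) = k ∧ M.graph.Adj u z ∧ ∀ c', c' ≠ c → E u c')
    hs1 hs1.env.n_eq hs1.env.n_lt (by decide) (fun s2 k2 hk2 hs2 hf2 hi2 => ?_)
  · exact ⟨key.1, fun z c ⟨u, hu, huv, hc⟩ => key.2 c c.2 _ _ ⟨u, hu, rfl, huv, hc⟩⟩
  have h21 : s2.reg 21 = k1 := (hf2 21 (by decide)).trans hi1
  have hcheck := check_run (u := ⟨k1, hk1⟩) (c := ⟨k2, hk2⟩) hs2.env h21 hi2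
  have hfr : ∀ r ∉ check.regs, (check.run s2).reg r = s2.reg r := fun r hr => run_reg hr s2
  have har : (check.run s2).arr = s2.arr := funext fun k => run_arr (by simp [check, forBelow,
    guard, ifNe, testMark, skip, arrs]) s2
  have hs3 : Good M a E (check.run s2) := hs2.congr (fun r hr => hfr r (by
    have : ∀ r ∈ check.regs, 11 ≤ r := by decide
    exact fun h => absurd (this r h) (by omega))) har
  have e : (check ;; ite 30 push skip).run s2 =
    if (check.run s2).reg 30 = 0 then skip.run (check.run s2) else push.run (check.run s2) := rfl
  rw [e]
  split_ifs with hflag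
  · refine ⟨skip_good hs3, fun z c ⟨u, hu, hc, huz, h⟩ => absurd hflag (hcheck.2 fun c' hc' => ?_)⟩
    subst hu hc
    exact hs2.marked _ _ (h c' hc')
  · have := good_push (u := ⟨k1, hk1⟩) (c := ⟨k2, hk2⟩) hs3
      ((hfr 21 (by decide)).trans h21) ((hfr 22 (by decide)).trans hi2)
      fun c' hc' => hs2.sound _ _ (hcheck.1 hflag c' hc')
    refine ⟨this.1, fun z c ⟨u, hu, hc, huz, h⟩ => ?_⟩
    subst hu hc
    exact this.2 z huz

end BProg

end GraphSim
namespace GraphSim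

variable {p q n : ℕ} {M : MarkedGraph p q n} {a : Fin p → Fin n} {E : Fin M.ν → Fin n → Prop}

/-! ### Iterating rounds up to the fixed point -/

theorem Good.mono {s : State} (h : Good M a E s) {E' : Fin M.ν → Fin n → Prop}
    (hE : ∀ z c, E' z c → Marked s z c) : Good M a E' s :=
  ⟨h.env, h.sound, hE⟩

/-- If no more colors can be marked, then all dead colors are marked. -/
theorem marked_of_dead {s : State} (hi : ∀ z c, c ∉ M.initialLists a z → Marked s z c)
    (hadj : ∀ u v (c : Fin n), M.graph.Adj u v → (∀ c', c' ≠ c → Marked s u c') → Marked s v c)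
    {z : Fin M.ν} {c : Fin n} (h : Dead M a z c) : Marked s z c := by
  classical
  by_contra hm
  refine h (fun z => Finset.univ.filter fun c : Fin n => ¬ Marked s z c) (fun u v c huv hu hc => ?_)
    (fun z c hc => ?_) (by simpa using hm)
  · refine (Finset.mem_filter.1 hc).2 (hadj u v c huv fun c' hc' => ?_)
    by_contra hm
    exact hc' (Finset.mem_singleton.1 (hu (Finset.mem_filter.2 ⟨Finset.mem_univ c', hm⟩)))
  · by_contra hz
    exact (Finset.mem_filter.1 hc).2 (hi z c hz)

namespace BProg

theorem run_seq (P Q : BProg) (s : State) : (P ;; Q).run s = Q.run (P.run s) := rfl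

/-- Mark all dead colors. -/
def propagate : BProg := initX ;; initR ;; rep 25 round

-- There are only `ν * n` possible marks, and at least that many rounds. A round either starts from
-- a fixed point, where every dead color is marked by `marked_of_dead`, or adds a mark.
open Classical in
theorem propagate_run {s : State} (hs : Good M a (fun _ _ => False) s) :
    Env M a (propagate.run s) ∧ ∀ z c, Marked (propagate.run s) z c ↔ Dead M a z c := by
  obtain ⟨g1, m1⟩ := good_initX hs
  obtain ⟨g2, m2⟩ := good_initR (g1.mono (E' := fun z c => ∃ j, M.x j = z ∧ c ≠ a j)
    (by rintro z c ⟨j, rfl, hc⟩; exact m1 j c hc))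
  have g3 := g2.mono (E' := fun z c => c ∉ M.initialLists a z) (by
    intro z c hc
    simp only [MarkedGraph.initialLists, Finset.mem_filter, Finset.mem_univ, true_and,
      not_and_or, not_forall] at hc
    rcases hc with ⟨j, hj, hc⟩ | ⟨i, rfl, hc⟩
    · exact g2.marked _ _ ⟨j, hj, hc⟩
    · exact m2 i c hc)
  have hrun : propagate.run s = (rep 25 round).run (initR.run (initX.run s)) := rfl
  rw [hrun]
  generalize initR.run (initX.run s) = t at g3
  set U : State → Finset (Fin M.ν × Fin n) := fun s => Finset.univ.filter fun x => Marked s x.1 x.2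
    with hU
  -- With `k` rounds to go, either all dead colors are marked or there are at least `t.reg 0 - k`
  -- marks, one for each round done.
  have key := iter_induction (f := round.run) (i := 25) (k := t.reg 0)
    (s := t.setReg 25 (t.reg 0))
    (fun k s => Good M a (fun z c => c ∉ M.initialLists a z) s ∧ s.reg 0 = t.reg 0 ∧
      ((∀ z c, Dead M a z c → Marked s z c) ∨ t.reg 0 ≤ (U s).card + k))
    ⟨g3.setReg (by norm_num), by simp, .inr (by simp)⟩ (by
      rintro k s' hk ⟨hg, h0, hor⟩
      have hg' := hg.setReg (r := 25) (v := k) (by norm_num)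
      obtain ⟨r1, r2⟩ := good_round (hg'.mono (E' := Marked (s'.setReg 25 k)) fun _ _ h => h)
      set s2 := round.run (s'.setReg 25 k)
      have hmono : ∀ z c, Marked s' z c → Marked s2 z c := fun z c h => r1.marked z c h
      refine ⟨r1.mono fun z c hz => r1.marked z c (hg'.marked z c hz), ?_, ?_⟩
      · have : s2.reg 0 = (s'.setReg 25 k).reg 0 := run_reg (by decide) _
        rw [this]
        simpa using h0
      · rcases hor with hall | hcard
        · exact .inl fun z c h => hmono z c (hall z c h)
        · by_cases hcl : ∀ u v (c : Fin n), M.graph.Adj u v → (∀ c', c' ≠ c → Marked s' u c') → Marked s' v c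
          · exact .inl fun z c h => hmono z c (marked_of_dead hg.marked hcl h)
          · push Not at hcl
            obtain ⟨u, v, c, huv, hc, hv⟩ := hcl
            right
            have : U s' ⊂ U s2 := by
              refine Finset.ssubset_iff_subset_ne.2 ⟨fun x hx => ?_, fun h => hv ?_⟩
              · simp only [hU, Finset.mem_filter, Finset.mem_univ, true_and] at hx ⊢
                exact hmono _ _ hx
              · have hin : (v, c) ∈ U s2 := by
                  simp only [hU, Finset.mem_filter, Finset.mem_univ, true_and]
                  exact r2 u v c huv hc
                rw [← h] at hin
                simpa [hU] using hin
            have := Finset.card_lt_card this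
            omega)
  have hrep : (rep 25 round).run t = iter round.run 25 (t.reg 0) (t.setReg 25 (t.reg 0)) := rfl
  rw [hrep]
  generalize iter round.run 25 (t.reg 0) (t.setReg 25 (t.reg 0)) = s' at key
  obtain ⟨hg, h0, hor⟩ := key
  refine ⟨hg.env, fun z c => ⟨hg.sound z c, ?_⟩⟩
  rcases hor with hall | hcard
  · exact hall z c
  · intro _
    have hle : (Finset.univ : Finset (Fin M.ν × Fin n)).card ≤ (U s').card := by
      have := hg.env.prod_le
      simp only [Finset.card_univ, Fintype.card_prod, Fintype.card_fin]
      omega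
    have := Finset.eq_univ_of_card _ (le_antisymm (Finset.card_le_univ _) hle)
    have hin : (z, c) ∈ U s' := by rw [this]; exact Finset.mem_univ _
    simpa [hU] using hin

/-! ### The output -/

/-- Count in `reg 31` the colors that are not marked at the vertex `reg 21`. -/
def count : BProg :=
  const 31 0 ;; forBelow 4 22 (load 4 45 21 ;; add 45 45 22 ;; load 2 46 45 ;;
    ite 46 skip (add 31 31 2))

open Classical in
theorem count_run {s : State} (hs : Env M a s) {z : Fin M.ν} (hz : s.reg 21 = z) :
    (count.run s).reg 31 = (Finset.univ.filter fun c : Fin n => ¬ Marked s z c).card := by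
  have hmul := hs.muln z (z.2.trans hs.ν_lt)
  have key := forBelow_induction (d := 4) (i := 22) (P := load 4 45 21 ;; add 45 45 22 ;;
      load 2 46 45 ;; ite 46 skip (add 31 31 2))
    (fun k s' => s'.arr = s.arr ∧ s'.reg 21 = z ∧ s'.reg 2 = 1 ∧
      s'.reg 31 = (Finset.univ.filter fun c : Fin n => k ≤ c ∧ ¬ Marked s z c).card) (b := n)
    (s := (const 31 0).run s) (by simpa [run] using hs.n_lt.le) (by simpa [run] using hs.n_eq)
    (by decide) (by decide) ?_ ?_ ?_
  · simpa [count, run] using key.2.2.2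
  · intro k s' r v hr ⟨h1, h2, h3, h4⟩
    simp only [List.mem_cons, List.not_mem_nil, or_false] at hr
    have e21 : 21 ≠ r := by omega
    have e2 : 2 ≠ r := by omega
    have e31 : 31 ≠ r := by omega
    simp only [State.setReg_arr, State.setReg_reg, e21, e2, e31, if_false]
    exact ⟨h1, h2, h3, h4⟩
  · refine ⟨rfl, by simpa [run] using hz, by simpa [run] using hs.one, ?_⟩
    simp only [run, State.setReg_reg, if_true]
    symm
    rw [Finset.card_eq_zero, Finset.filter_eq_empty_iff]
    exact fun c _ h => absurd c.2 (by omega)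
  · intro k s' hk ⟨h1, h2, h3, h4⟩ hik
    by_cases hm : s.arr 2 (z * n + k) = 0
    · have : (Finset.univ.filter fun c : Fin n => k ≤ c ∧ ¬ Marked s z c) =
          insert ⟨k, hk⟩ (Finset.univ.filter fun c : Fin n => k + 1 ≤ c ∧ ¬ Marked s z c) := by
        ext c
        simp only [Finset.mem_filter, Finset.mem_univ, true_and, Finset.mem_insert]
        constructor
        · rintro ⟨hc, hc'⟩
          rcases eq_or_lt_of_le hc with he | hlt
          · exact .inl (Fin.ext he.symm)
          · exact .inr ⟨hlt, hc'⟩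
        · rintro (rfl | ⟨hc, hc'⟩)
          · exact ⟨le_rfl, by simp [Marked, hm]⟩
          · exact ⟨by omega, hc'⟩
      rw [this, Finset.card_insert_of_notMem (by simp)]
      simp [run, h1, h2, h3, h4, hik, hmul, hm]
    · have : (Finset.univ.filter fun c : Fin n => k ≤ c ∧ ¬ Marked s z c) =
          Finset.univ.filter fun c : Fin n => k + 1 ≤ c ∧ ¬ Marked s z c := by
        ext c
        simp only [Finset.mem_filter, Finset.mem_univ, true_and]
        refine ⟨fun ⟨hc, hc'⟩ => ⟨?_, hc'⟩, fun ⟨hc, hc'⟩ => ⟨by omega, hc'⟩⟩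
        rcases eq_or_lt_of_le hc with he | hlt
        · exact absurd (by rw [Marked, ← he]; exact hm) hc'
        · exact hlt
      rw [this]
      simp [run, skip, h1, h2, h3, h4, hik, hmul, hm]

/-- Decide in `reg 30` whether each vertex has exactly one color that is not marked. -/
def checkAll : BProg :=
  const 30 1 ;; forBelow 3 21 (count ;; ifNe 31 2 (const 30 0))

open Classical in
theorem checkAll_run {s : State} (hs : Env M a s) :
    (checkAll.run s).reg 30 =
      if ∀ z : Fin M.ν, (Finset.univ.filter fun c : Fin n => ¬ Marked s z c).card = 1 then 1 else 0 := by
  have key := forBelow_induction (d := 3) (i := 21) (P := count ;; ifNe 31 2 (const 30 0))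
    (fun k s' => s'.arr = s.arr ∧ (∀ r < 11, s'.reg r = s.reg r) ∧
      s'.reg 30 = if ∀ z : Fin M.ν, k ≤ z →
        (Finset.univ.filter fun c : Fin n => ¬ Marked s z c).card = 1 then 1 else 0) (b := M.ν)
    (s := (const 30 1).run s) (by simpa [run] using hs.ν_lt.le) (by simpa [run] using hs.ν_eq)
    (by decide) (by decide) ?_ ?_ ?_
  · simpa [checkAll, run] using key.2.2
  · intro k s' r v hr ⟨h1, h2, h3⟩
    simp only [List.mem_cons, List.not_mem_nil, or_false] at hr
    have e30 : 30 ≠ r := by omega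
    refine ⟨h1, fun r' hr' => ?_, ?_⟩
    · have : r' ≠ r := by omega
      simp [this, h2 r' hr']
    · simp only [State.setReg_reg, e30, if_false]
      exact h3
  · refine ⟨rfl, fun r hr => ?_, ?_⟩
    · have : r ≠ 30 := by omega
      simp [run, this]
    · rw [if_pos fun z hz => absurd z.2 (by omega)]
      simp [run]
  · intro k s' hk ⟨h1, h2, h3⟩ hik
    have henv : Env M a s' := hs.congr h2 (by rw [h1]) (by rw [h1]) (by rw [h1])
    have hcount := count_run (z := ⟨k, hk⟩) henv hik
    have hcarr : (count.run s').arr = s.arr := by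
      rw [← h1]
      exact funext fun k => run_arr (by simp [count, forBelow, guard, skip, arrs]) s'
    have hcreg : ∀ r ∉ count.regs, (count.run s').reg r = s'.reg r := fun r hr => run_reg hr s'
    -- Register `2` holds the constant `1` with which the count is compared.
    obtain ⟨s2, ha2, hr2, e2⟩ := ifNe_run (i := 31) (j := 2) (const 30 0) (count.run s')
      (by norm_num) (by norm_num)
    have hsplit : (∀ z : Fin M.ν, k ≤ z →
          (Finset.univ.filter fun c : Fin n => ¬ Marked s z c).card = 1) ↔
        (Finset.univ.filter fun c : Fin n => ¬ Marked s (⟨k, hk⟩ : Fin M.ν) c).card = 1 ∧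
          ∀ z : Fin M.ν, k + 1 ≤ z → (Finset.univ.filter fun c : Fin n => ¬ Marked s z c).card = 1 :=
      ⟨fun h => ⟨h _ le_rfl, fun z hz => h z (by omega)⟩, fun h z hz => by
        rcases eq_or_lt_of_le hz with he | hlt
        · have : z = ⟨k, hk⟩ := Fin.ext he.symm
          exact this ▸ h.1
        · exact h.2 z hlt⟩
    have hmarked : ∀ c : Fin n, Marked s' (⟨k, hk⟩ : Fin M.ν) c ↔ Marked s (⟨k, hk⟩ : Fin M.ν) c := by
      simp [Marked, h1]
    simp only [hmarked] at hcount
    have hrun : (count ;; ifNe 31 2 (const 30 0)).run s' =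
      (ifNe 31 2 (const 30 0)).run (count.run s') := rfl
    have hlow : ∀ r < 11, s2.reg r = s.reg r := fun r hr => by
      have : ∀ r ∈ count.regs, 11 ≤ r := by decide
      rw [hr2 r (by omega), hcreg r fun h => absurd (this r h) (by omega), h2 r hr]
    rw [hrun, e2, hcount, hcreg 2 (by decide), henv.one]
    split_ifs with hc hall hall
    · have h30 : s2.reg 30 = 1 := by
        rw [hr2 30 (by norm_num), hcreg 30 (by decide), h3, if_pos (hsplit.1 hall).2]
      refine ⟨ha2.trans hcarr, fun r hr => ?_, by simpa [run, skip] using h30⟩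
      have : r ≠ 41 := by omega
      simp [run, skip, this, hlow r hr]
    · have h30 : s2.reg 30 = 0 := by
        rw [hr2 30 (by norm_num), hcreg 30 (by decide), h3, if_neg fun h => hall (hsplit.2 ⟨hc, h⟩)]
      refine ⟨ha2.trans hcarr, fun r hr => ?_, by simpa [run, skip] using h30⟩
      have : r ≠ 41 := by omega
      simp [run, skip, this, hlow r hr]
    · exact absurd (hsplit.1 hall).1 hc
    · refine ⟨ha2.trans hcarr, fun r hr => ?_, by simp [run]⟩
      have : r ≠ 30 := by omega
      simp [run, this, hlow r hr]

/-- Write the colors that are not marked to the array `1`, after the first place. -/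
def writeAll : BProg :=
  forBelow 33 21 (load 2 46 21 ;; add 45 21 2 ;; ite 46 (store 1 45 1) (store 1 45 2))

/-- Marks and output matrix are both stored row by row, so the output is the entrywise negation of
the marks, shifted by one place to spare the leading answer bit. -/
theorem writeAll_run {s : State} (h1 : s.reg 1 = 0) (h2 : s.reg 2 = 1)
    (hb : s.reg 33 ≤ s.reg 0) :
    (writeAll.run s).arr 1 0 = s.arr 1 0 ∧ ∀ k < s.reg 33,
      (writeAll.run s).arr 1 (k + 1) = if s.arr 2 k = 0 then 1 else 0 := by
  have key := forBelow_induction (d := 33) (i := 21)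
    (P := load 2 46 21 ;; add 45 21 2 ;; ite 46 (store 1 45 1) (store 1 45 2))
    (fun k s' => s'.reg 1 = 0 ∧ s'.reg 2 = 1 ∧ s'.arr 2 = s.arr 2 ∧ s'.arr 1 0 = s.arr 1 0 ∧
      ∀ k' < s.reg 33, k ≤ k' → s'.arr 1 (k' + 1) = if s.arr 2 k' = 0 then 1 else 0)
    (b := s.reg 33) (s := s) hb rfl (by decide) (by decide) ?_ ?_ ?_
  · exact ⟨key.2.2.2.1, fun k hk => key.2.2.2.2 k hk (Nat.zero_le k)⟩
  · intro k s' r v hr ⟨h1, h2, h3⟩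
    simp only [List.mem_cons, List.not_mem_nil, or_false] at hr
    have e1 : 1 ≠ r := by omega
    have e2 : 2 ≠ r := by omega
    simp only [State.setReg_arr, State.setReg_reg, e1, e2, if_false]
    exact ⟨h1, h2, h3⟩
  · exact ⟨h1, h2, rfl, rfl, fun k' hk hk' => absurd hk (by omega)⟩
  · intro k s' hk ⟨e1, e2, e3, e4, e5⟩ hik
    by_cases hm : s.arr 2 k = 0
    · refine ⟨by simp [run, hik, e3, hm, e1], by simp [run, hik, e3, hm, e2],
        funext fun i => by simp [run, hik, e3, hm], by simp [run, hik, e3, hm, e2, e4],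
        fun k' hk' hkk => ?_⟩
      by_cases hkk' : k' = k
      · simp [run, hik, e3, hm, e2, hkk']
      · simp [run, hik, e3, hm, e2, hkk', e5 k' hk' (by omega)]
    · refine ⟨by simp [run, hik, e3, hm, e1], by simp [run, hik, e3, hm, e2],
        funext fun i => by simp [run, hik, e3, hm], by simp [run, hik, e3, hm, e2, e4],
        fun k' hk' hkk => ?_⟩
      by_cases hkk' : k' = k
      · simp [run, hik, e3, hm, e1, e2, hkk']
      · simp [run, hik, e3, hm, e2, hkk', e5 k' hk' (by omega)]

/-- Write the answer to the array `1` and its length to `reg 32`. -/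
def write : BProg :=
  const 43 0 ;; store 1 43 30 ;; load 4 33 3 ;; const 32 1 ;;
    ite 30 (writeAll ;; add 32 33 2) skip

/-- The forcing algorithm, with the length of its output in `reg 32`. -/
def main : BProg := setup ;; propagate ;; checkAll ;; write

end BProg

/-! ### Correctness of the complete algorithm -/

/-- The forcing algorithm. -/
def algorithm : Prog := .seq (.const 2 1) (.seq BProg.main.toProg (.add 0 32 1))

/-- A bound for its number of steps. -/
noncomputable def algorithmTime : Polynomial ℕ := BProg.main.time + 2

open Classical in
theorem answer_of_card {ν : ℕ} {L : Fin ν → Finset (Fin n)} (h : ∀ z, (L z).card = 1) :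
    answer L = true :: bitMatrix fun z c => c ∈ L z := by
  have h' : ∀ z, ∃ c, L z = {c} := fun z => Finset.card_eq_one.1 (h z)
  rw [answer, dif_pos h', foundCode]
  congr 2
  funext z c
  rw [eq_iff_iff]
  conv_rhs => rw [(h' z).choose_spec, Finset.mem_singleton]
  exact eq_comm

theorem answer_of_not_card {ν : ℕ} {L : Fin ν → Finset (Fin n)} (h : ¬ ∀ z, (L z).card = 1) :
    answer L = noneCode :=
  dif_neg fun h' => h fun z => Finset.card_eq_one.2 (h' z)

theorem answer_singleton {ν : ℕ} (σ : Fin ν → Fin n) :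
    answer (fun z => ({σ z} : Finset (Fin n))) = foundCode σ := by
  rw [answer_of_card fun z => Finset.card_singleton _, foundCode]
  simp only [Finset.mem_singleton, eq_comm]

/-- The vertex `z` is essential: without vertices all lists are vacuously singletons, and the answer
would be the empty coloring. -/
theorem answer_empty {ν : ℕ} (z : Fin ν) :
    answer (fun _ => (∅ : Finset (Fin n)) : Fin ν → Finset (Fin n)) = noneCode :=
  answer_of_not_card fun h => by simpa using h z

open Classical in
/-- The algorithm outputs the answer that is read off from the normal form. -/
theorem algorithm_outputsWithin (M : MarkedGraph p q n) (a : Fin p → Fin n)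
    {L : Fin M.ν → Finset (Fin n)} (hL : IsNormalForm M.graph (M.initialLists a) L) :
    algorithm.OutputsWithin (M.code a) (answer L) (algorithmTime.eval (M.code a).length) := by
  obtain ⟨s0, hs0⟩ : ∃ s0, s0 = (State.init (M.code a)).setReg 2 1 := ⟨_, rfl⟩
  have hz0 : s0.reg 0 = (M.code a).length := by simp [hs0, State.init]
  have hz1 : s0.reg 1 = 0 := by simp [hs0, State.init]
  have hz2 : s0.reg 2 = 1 := by simp [hs0]
  have henv : Env M a (BProg.setup.run s0) :=
    env_setup M a hz0 hz1 hz2 (by simp [hs0, State.init])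
      (by rw [hs0]; exact holds_init _)
  have harr2 : ∀ k, (BProg.setup.run s0).arr 2 k = 0 := fun k => by
    rw [BProg.run_arr (by decide)]
    simp [hs0, State.init]
  obtain ⟨henv1, hmarked⟩ := BProg.propagate_run (M := M) (a := a) (s := BProg.setup.run s0)
    ⟨henv, fun z c h => absurd (harr2 _) h, fun _ _ h => h.elim⟩
  obtain ⟨s1, hs1⟩ : ∃ s1, s1 = BProg.propagate.run (BProg.setup.run s0) := ⟨_, rfl⟩
  rw [← hs1] at henv1
  simp only [← hs1] at hmarked
  -- A color that is not dead lies in some stable family, and that family lies below the normal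
  -- form; conversely, the normal form is itself such a family.
  have hmem : ∀ z c, c ∈ L z ↔ ¬ Marked s1 z c := by
    intro z c
    rw [hmarked]
    constructor
    · exact fun h hd => hd L (stable_of_irreducible hL.2) (le_of_reflTransGen hL.1) h
    · intro h
      simp only [Dead, not_forall, not_not] at h
      obtain ⟨L', hst, hle, hc⟩ := h
      exact hst.le_of_reduces hle hL.1 z hc
  have hfilter : ∀ z, (Finset.univ.filter fun c : Fin n => ¬ Marked s1 z c) = L z := by
    intro z
    ext c
    simp [hmem]
  have hflag := BProg.checkAll_run henv1
  simp only [hfilter] at hflag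
  obtain ⟨s2, hs2⟩ : ∃ s2, s2 = BProg.checkAll.run s1 := ⟨_, rfl⟩
  rw [← hs2] at hflag
  have hfr2 : ∀ r ∉ BProg.checkAll.regs, s2.reg r = s1.reg r := fun r hr => by
    rw [hs2, BProg.run_reg hr]
  have har2 : ∀ k, s2.arr k = s1.arr k := fun k => by
    rw [hs2, BProg.run_arr]
    simp [BProg.checkAll, BProg.forBelow, BProg.guard, BProg.ifNe, BProg.count, BProg.skip,
      BProg.arrs]
  obtain ⟨t, ht, hexec⟩ := BProg.exec (P := BProg.main) (by decide) (by decide) (by decide)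
    (by decide) hz1 hz2
  have hmain : BProg.main.run s0 = BProg.write.run s2 := by
    rw [BProg.main, BProg.run_seq, BProg.run_seq, BProg.run_seq, ← hs1, ← hs2]
  rw [hmain] at hexec
  rw [hz0] at ht
  have hone : (BProg.write.run s2).reg 1 = 0 := by
    rw [BProg.run_reg (by decide), hfr2 1 (by decide), henv1.zero]
  -- One step puts `1` in register `2` beforehand. Another moves the output length to register `0`
  -- at the very end, since until then that register controls all loops.
  refine ⟨1 + (t + 1), (BProg.write.run s2).setReg 0 ((BProg.write.run s2).reg 32), ?_, ?_, ?_⟩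
  · simp [algorithmTime]
    omega
  · rw [hs0] at hexec
    refine .seq (.const 2 1 _) (hexec.seq ?_)
    have := Exec.add 0 32 1 (BProg.write.run s2)
    rwa [hone, Nat.add_zero] at this
  · set s3 := (((s2.setReg 43 0).setArr 1 0 (s2.reg 30)).setReg 33
      (M.ν * n)).setReg 32 1 with hs3
    have hmul : s2.arr 4 (s2.reg 3) = M.ν * n := by
      rw [har2, hfr2 3 (by decide), henv1.ν_eq, henv1.muln _ henv1.ν_lt]
    have hwrite : BProg.write.run s2 = if s2.reg 30 = 0 then BProg.skip.run s3 else
        (BProg.add 32 33 2).run (BProg.writeAll.run s3) := by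
      simp [BProg.write, BProg.run, hs3, hmul]
    by_cases hall : ∀ z, (L z).card = 1
    · rw [if_pos hall] at hflag
      rw [hwrite, if_neg (by omega), answer_of_card hall]
      have e1 : s3.reg 1 = 0 := by simp [hs3, hfr2 1 (by decide), henv1.zero]
      have e2 : s3.reg 2 = 1 := by simp [hs3, hfr2 2 (by decide), henv1.one]
      have e33 : s3.reg 33 = M.ν * n := by simp [hs3]
      have e0 : s3.reg 0 = s1.reg 0 := by simp [hs3, hfr2 0 (by decide)]
      obtain ⟨w0, w1⟩ := BProg.writeAll_run e1 e2 (by rw [e33, e0]; exact henv1.prod_le)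
      have f33 : (BProg.writeAll.run s3).reg 33 = M.ν * n :=
        (BProg.run_reg (by decide) s3).trans e33
      have f2 : (BProg.writeAll.run s3).reg 2 = 1 := (BProg.run_reg (by decide) s3).trans e2
      refine ⟨by simp [BProg.run, f33, f2, bitMatrix_length], fun i hi => ?_⟩
      have harr : (((BProg.add 32 33 2).run (BProg.writeAll.run s3)).setReg 0
          (((BProg.add 32 33 2).run (BProg.writeAll.run s3)).reg 32)).arr =
          (BProg.writeAll.run s3).arr := rfl
      rw [harr]
      cases i with
      | zero =>
        rw [w0]
        simp [hs3, hflag]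
      | succ k =>
        have hk : k < M.ν * n := by simpa [bitMatrix_length] using hi
        rw [w1 k (by omega)]
        obtain ⟨⟨z, c⟩, hzc⟩ := finProdFinEquiv.surjective ⟨k, hk⟩
        have hk' : k = z * n + c := by
          have := congrArg Fin.val hzc
          simp only [finProdFinEquiv, Equiv.coe_fn_mk] at this
          rw [← this, Nat.mul_comm, Nat.add_comm]
        subst hk'
        simp only [List.getElem_cons_succ, bitMatrix_getElem, hmem]
        have e3 : s3.arr 2 (z * n + c) = s1.arr 2 (z * n + c) := by simp [hs3, har2]
        rw [e3]
        by_cases hm : s1.arr 2 (z * n + c) = 0 <;> simp [Marked, hm]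
    · rw [if_neg hall] at hflag
      rw [hwrite, if_pos hflag, answer_of_not_card hall]
      refine ⟨by simp [BProg.skip, BProg.run, hs3, noneCode], fun i hi => ?_⟩
      have : i = 0 := by simpa [noneCode] using hi
      subst this
      simp [BProg.skip, BProg.run, hs3, noneCode, hflag]

end GraphSim

/-! ### Assembly of the theorem -/

theorem mainTheorem2 :
    ∃ (alg : GraphSim.Prog) (T : Polynomial ℕ) (K : ℕ),
      -- On every marked graph and every assignment to its input vertices, the algorithm finds
      -- the (unique) normal form under direct forcing, and reads the answer off from it.
      (∀ (p q n : ℕ) (M : GraphSim.MarkedGraph p q n) (a : Fin p → Fin n),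
        ∃ L : Fin M.ν → Finset (Fin n),
          GraphSim.IsNormalForm M.graph (M.initialLists a) L ∧
          (∀ L', GraphSim.IsNormalForm M.graph (M.initialLists a) L' → L' = L) ∧
          alg.OutputsWithin (M.code a) (GraphSim.answer L) (T.eval (M.code a).length)) ∧
      -- Every partial function is simulated by a graph on which this answer is correct.
      (∀ (p q m n : ℕ), 1 ≤ p → 1 ≤ q → 2 ≤ m → max m 3 ≤ n →
        ∀ φ : (Fin p → Fin m) →. (Fin q → Fin m),
        ∃ M : GraphSim.MarkedGraph p q n,
          M.Simulates φ ∧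
          (∀ Θ : ℕ, 1 ≤ Θ → GraphSim.HasPresentation φ Θ →
            M.ν ≤ K * (Θ * (p + q) * n ^ (2 * (p + q) + 4)) ∧
            M.graph.edgeSet.ncard ≤ K * (Θ * (p + q) * n ^ (3 * (p + q) + 5))) ∧
          ∀ a : Fin p → Fin n,
            (∃ σ : M.graph.Coloring (Fin n), M.Extends a σ ∧
              (∀ τ : M.graph.Coloring (Fin n), M.Extends a τ → τ = σ) ∧
              GraphSim.IsNormalForm M.graph (M.initialLists a) (fun z => {σ z}) ∧
              alg.OutputsWithin (M.code a) (GraphSim.foundCode σ) (T.eval (M.code a).length)) ∨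
            ((¬ ∃ σ : M.graph.Coloring (Fin n), M.Extends a σ) ∧
              GraphSim.IsNormalForm M.graph (M.initialLists a) (fun _ => ∅) ∧
              alg.OutputsWithin (M.code a) GraphSim.noneCode (T.eval (M.code a).length))) := by
  -- `144` is the square of the constant `12` in the vertex bound, as needed for the edges.
  refine ⟨GraphSim.algorithm, GraphSim.algorithmTime, 144, fun p q n M a => ?_,
    fun p q m n hp hq _ hmn φ => ?_⟩
  · obtain ⟨L, hL⟩ := GraphSim.exists_isNormalForm M.graph (M.initialLists a)
    exact ⟨L, hL, fun L' hL' => hL.unique hL', GraphSim.algorithm_outputsWithin M a hL⟩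
  · obtain ⟨M, hM, hsize, hcases⟩ := GraphSim.exists_simulates hp hq hmn φ
    refine ⟨M, hM, fun Θ hΘ _ => hsize Θ hΘ, fun a => ?_⟩
    rcases hcases a with ⟨σ, hσ, huniq, hnf⟩ | ⟨hno, hnf⟩
    · refine .inl ⟨σ, hσ, huniq, hnf, ?_⟩
      have := GraphSim.algorithm_outputsWithin M a hnf
      rwa [GraphSim.answer_singleton] at this
    · refine .inr ⟨hno, hnf, ?_⟩
      have := GraphSim.algorithm_outputsWithin M a hnf
      rwa [GraphSim.answer_empty (M.x ⟨0, hp⟩)] at this
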